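/- **Definitions.** A pointed extended metric space $(X,x_0)$ is a set $X$ with a metric $d_X$ with values in $[0,+\infty]$ and a point $x_0\in X$. For two such spaces write $(X,x_0)\precsim(Y,y_0)$ if for all finitely many points $x_1,\dots,x_N\in X$ there are points $y_{i,k}\in Y$ ($0\le i\le N$, $k=1,2,\dots$) with $y_{0,k}=y_0$ for all $k$ and $$d_X(x_i,x_j)\le\liminf_{k\to\infty}d_Y(y_{i,k},y_{j,k})\qquad\text{for all distinct } i,j\in\{0,\dots,N\}.$$ Write $(X,x_0)\sim(Y,y_0)$ if both $(X,x_0)\precsim(Y,y_0)$ and $(Y,y_0)\precsim(X,x_0)$; this is an equivalence relation. Let $\mathcal M_0/\!\sim$ be the space of pointed extended metric spaces modulo $\sim$. Let $\mathcal H_0$ be the pointed Gromov–Hausdorff space: the set of isometry classes (by isometries preserving base points) of pointed compact metric spaces, with the pointed Gromov–Hausdorff metric $$d_{GH}((X,x_0),(Y,y_0))=\inf\ \max\{d_H(\varphi(X),\psi(Y)),\,d_Z(\varphi(x_0),\psi(y_0))\},$$ the infimum being over all isometric embeddings $\varphi:X\to Z$, $\psi:Y\to Z$ into compact metric spaces $Z$.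 Here $d_H$ is the Hausdorff distance. For an integer $N\ge1$ let $\mathcal H_0(N,N)\subset\mathcal H_0$ consist of the spaces with at most $N$ points and diameter at most $N$. For a pointed extended metric space $(X,x_0)$ let $\mathcal P_{(X,x_0)}=\{(Y,y_0)\in\mathcal H_0 : (Y,y_0)\precsim(X,x_0)\}$, and put $$\rho((X,x_0),(Y,y_0))=\sum_{N=1}^\infty 2^{-N}\,d_H\bigl(\mathcal P_{(X,x_0)}\cap\mathcal H_0(N,N),\ \mathcal P_{(Y,y_0)}\cap\mathcal H_0(N,N)\bigr),$$ where $d_H$ is the Hausdorff distance with respect to the pointed Gromov–Hausdorff metric. For a non-principal ultrafilter $\omega$ on $\mathbb N$, the pointed ultralimit of a sequence $(X_n,x_{0,n})$ of pointed extended metric spaces is the pointed extended metric space obtained from $\prod_n X_n$ with the pseudometric $\lim_{n\to\omega}d_{X_n}(a_n,b_n)\in[0,+\infty]$ by identifying points at distance $0$, with base point the class of $(x_{0,n})_n$. (Points at infinite distance from the base point are kept.) **Theorem.** 1. $\rho$ induces a metric on $\mathcal M_0/\!\sim$, and $(\mathcal M_0/\!\sim,\rho)$ is a compact metric space. 2.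 The natural projection $\mathcal H_0\to\mathcal M_0/\!\sim$ is $3$-Lipschitz and a topological embedding. 3. The image of the projection in (2) is dense in $(\mathcal M_0/\!\sim,\rho)$. 4. If $(X_n,x_{0,n})$, $n\in\mathbb N$, and $(Y,y_0)$ are pointed extended metric spaces with $\rho((X_n,x_{0,n}),(Y,y_0))\to0$, then for every non-principal ultrafilter on $\mathbb N$ the pointed ultralimit of $(X_n,x_{0,n})$ is $\sim$-equivalent to $(Y,y_0)$. -/

import Mathlib

open Filter Topology
open scoped ENNReal

universe u

/-! ### Pointed extended metric spaces and pointed compact metric spaces -/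

/-- A pointed extended metric space: distances take values in `[0, ∞]`, and distinct points have
positive distance. -/
structure PtEMet : Type (u + 1) where
  carrier : Type u
  [emetric : EMetricSpace carrier]
  base : carrier

attribute [instance] PtEMet.emetric

/-- A pointed compact metric space. -/
structure PtCpt : Type (u + 1) where
  carrier : Type u
  [metric : MetricSpace carrier]
  [compact : CompactSpace carrier]
  base : carrier

attribute [instance] PtCpt.metric PtCpt.compact

/-- A pointed compact metric space, viewed as a pointed extended metric space. -/
def PtCpt.toPtEMet (X : PtCpt.{u}) : PtEMet.{u} where
  carrier := X.carrier
  base := X.base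

/-! ### The relations `≾` and `∼` -/

/-- `(X, x₀) ≾ (Y, y₀)`: every finite family `x₀, x₁, …, x_N` of points of `X` that starts with the
base point admits points `y_{i,k}` of `Y` with `y_{0,k} = y₀` and
`d(x_i, x_j) ≤ liminf_k d(y_{i,k}, y_{j,k})` for distinct `i, j`. -/
def Precsim (X Y : PtEMet.{u}) : Prop :=
  ∀ (N : ℕ) (x : Fin (N + 1) → X.carrier), x 0 = X.base →
    ∃ y : Fin (N + 1) → ℕ → Y.carrier, (∀ k, y 0 k = Y.base) ∧
      ∀ i j, i ≠ j → edist (x i) (x j) ≤ liminf (fun k => edist (y i k) (y j k)) atTop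

theorem Precsim.refl (X : PtEMet.{u}) : Precsim X X := fun _ x hx =>
  ⟨fun i _ => x i, fun _ => hx, fun i j _ => by simp⟩

theorem Precsim.of_isometry {X Y : PtEMet.{u}} (f : X.carrier → Y.carrier) (hf : Isometry f)
    (h0 : f X.base = Y.base) : Precsim X Y := fun _ x hx =>
  ⟨fun i _ => f (x i), fun _ => by simp only [hx, h0], fun i j _ => by simp [hf.edist_eq]⟩

theorem precsim_iff (X Y : PtEMet.{u}) : Precsim X Y ↔
    ∀ (N : ℕ) (x : Fin (N + 1) → X.carrier), x 0 = X.base → ∀ c : Fin (N + 1) → Fin (N + 1) → ℝ≥0∞,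
      (∀ i j, c i j = 0 ∨ c i j < edist (x i) (x j)) →
      ∃ y : Fin (N + 1) → Y.carrier, y 0 = Y.base ∧ ∀ i j, i ≠ j → c i j ≤ edist (y i) (y j) := by
  constructor
  · intro h N x hx c hc
    obtain ⟨y, hy0, hy⟩ := h N x hx
    have key : ∀ᶠ k in atTop, ∀ i j, i ≠ j → c i j ≤ edist (y i k) (y j k) := by
      rw [eventually_all]; intro i
      rw [eventually_all]; intro j
      by_cases hij : i = j
      · simp [hij]
      · rcases hc i j with h0 | hlt
        · simp [h0]
        · filter_upwards [eventually_lt_of_lt_liminf (hlt.trans_le (hy i j hij))] with k hk _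
          exact hk.le
    obtain ⟨k, hk⟩ := key.exists
    exact ⟨fun i => y i k, hy0 k, hk⟩
  · intro h N x hx
    have hs : ∀ d : ℝ≥0∞, ∃ s : ℕ → ℝ≥0∞, (∀ k, s k = 0 ∨ s k < d) ∧ Tendsto s atTop (𝓝 d) := by
      intro d
      rcases eq_or_ne d 0 with rfl | hd
      · exact ⟨fun _ => 0, fun _ => Or.inl rfl, tendsto_const_nhds⟩
      · obtain ⟨s, -, h2, h3⟩ := exists_seq_strictMono_tendsto' (pos_iff_ne_zero.2 hd)
        exact ⟨s, fun k => Or.inr (h2 k).2, h3⟩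
    choose s hs1 hs2 using hs
    choose y hy0 hy using fun k : ℕ =>
      h N x hx (fun i j => s (edist (x i) (x j)) k) (fun i j => hs1 _ k)
    refine ⟨fun i k => y k i, hy0, fun i j hij => ?_⟩
    rw [← (hs2 (edist (x i) (x j))).liminf_eq]
    exact liminf_le_liminf (Eventually.of_forall fun k => hy k i j hij)

theorem Precsim.trans {X Y Z : PtEMet.{u}} (h₁ : Precsim X Y) (h₂ : Precsim Y Z) :
    Precsim X Z := by
  rw [precsim_iff] at *
  intro N x hx c hc
  have hc' : ∀ i j, ∃ c' : ℝ≥0∞, (c' = 0 ∨ c' < edist (x i) (x j)) ∧ (c i j = 0 ∨ c i j < c') := by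
    intro i j
    rcases hc i j with h | h
    · exact ⟨0, Or.inl rfl, Or.inl h⟩
    · obtain ⟨c', h1, h2⟩ := exists_between h
      exact ⟨c', Or.inr h2, Or.inr h1⟩
  choose c' h1 h2 using hc'
  obtain ⟨y, hy0, hy⟩ := h₁ N x hx c' h1
  obtain ⟨z, hz0, hz⟩ := h₂ N y hy0 (fun i j => if i = j then 0 else c i j) (fun i j => by
    by_cases hij : i = j
    · simp [hij]
    · simpa [hij] using (h2 i j).imp id fun h => h.trans_le (hy i j hij))
  exact ⟨z, hz0, fun i j hij => by simpa [hij] using hz i j hij⟩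

/-- The equivalence relation `∼` on pointed extended metric spaces. -/
instance PtEMet.setoid : Setoid PtEMet.{u} where
  r X Y := Precsim X Y ∧ Precsim Y X
  iseqv :=
    { refl := fun X => ⟨Precsim.refl X, Precsim.refl X⟩
      symm := fun h => ⟨h.2, h.1⟩
      trans := fun h h' => ⟨h.1.trans h'.1, h'.2.trans h.2⟩ }

/-- The space `𝓜₀/∼` of pointed extended metric spaces up to `∼`
(isometric pointed spaces are `∼`-equivalent). -/
def MSpace : Type (u + 1) := Quotient PtEMet.setoid.{u}

/-- The class in `𝓜₀/∼` of a pointed extended metric space. -/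
def MSpace.mk (X : PtEMet.{u}) : MSpace.{u} := Quotient.mk PtEMet.setoid X

/-! ### The pointed Gromov-Hausdorff space -/

/-- Isometry of pointed compact metric spaces, by an isometry that preserves base points. -/
instance PtCpt.setoid : Setoid PtCpt.{u} where
  r X Y := ∃ e : X.carrier ≃ᵢ Y.carrier, e X.base = Y.base
  iseqv :=
    { refl := fun X => ⟨IsometryEquiv.refl _, rfl⟩
      symm := fun ⟨e, he⟩ => ⟨e.symm, by rw [← he, e.symm_apply_apply]⟩
      trans := fun ⟨e, he⟩ ⟨f, hf⟩ => ⟨e.trans f, by simp [he, hf]⟩ }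

/-- The pointed Gromov-Hausdorff space `𝓗₀`: isometry classes of pointed compact metric spaces. -/
def PtGHSpace : Type (u + 1) := Quotient PtCpt.setoid.{u}

/-- The isometry class of a pointed compact metric space. -/
def PtGHSpace.mk (X : PtCpt.{u}) : PtGHSpace.{u} := Quotient.mk PtCpt.setoid X

/-- The values `d_H(φ(X), ψ(Y)) ∨ d_Z(φ(x₀), ψ(y₀))`, where `φ : X → Z` and `ψ : Y → Z` run over the
isometric embeddings into compact metric spaces `Z`. -/
def couplingValues (X Y : PtCpt.{u}) : Set ℝ :=
  {r | ∃ (Z : Type u) (_ : MetricSpace Z) (_ : CompactSpace Z)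
      (φ : X.carrier → Z) (ψ : Y.carrier → Z), Isometry φ ∧ Isometry ψ ∧
      r = max (Metric.hausdorffDist (Set.range φ) (Set.range ψ)) (dist (φ X.base) (ψ Y.base))}

/-- The pointed Gromov-Hausdorff distance between pointed compact metric spaces. -/
noncomputable def ptGHDist (X Y : PtCpt.{u}) : ℝ := sInf (couplingValues X Y)

theorem couplingValues_nonneg {X Y : PtCpt.{u}} {r : ℝ} (h : r ∈ couplingValues X Y) : 0 ≤ r := by
  obtain ⟨Z, _, _, φ, ψ, -, -, rfl⟩ := h
  exact le_max_of_le_right dist_nonneg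

theorem couplingValues_bddBelow (X Y : PtCpt.{u}) : BddBelow (couplingValues X Y) :=
  ⟨0, fun _ h => couplingValues_nonneg h⟩

theorem couplingValues_nonempty (X Y : PtCpt.{u}) : (couplingValues X Y).Nonempty := by
  let _ : MetricSpace (X.carrier ⊕ Y.carrier) := Metric.metricSpaceSum
  exact ⟨_, X.carrier ⊕ Y.carrier, inferInstance, inferInstance, Sum.inl, Sum.inr,
    Metric.isometry_inl, Metric.isometry_inr, rfl⟩

theorem couplingValues_comm (X Y : PtCpt.{u}) : couplingValues X Y = couplingValues Y X := by
  have : ∀ X Y : PtCpt.{u}, couplingValues X Y ⊆ couplingValues Y X := by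
    rintro X Y _ ⟨Z, i, j, φ, ψ, hφ, hψ, rfl⟩
    exact ⟨Z, i, j, ψ, φ, hψ, hφ, by rw [Metric.hausdorffDist_comm, dist_comm]⟩
  exact (this X Y).antisymm (this Y X)

theorem couplingValues_subset_of_isometry {X X' Y : PtCpt.{u}} (h : X ≈ X') :
    couplingValues X Y ⊆ couplingValues X' Y := by
  obtain ⟨e, he⟩ := h
  rintro _ ⟨Z, i, j, φ, ψ, hφ, hψ, rfl⟩
  refine ⟨Z, i, j, φ ∘ e.symm, ψ, hφ.comp e.symm.isometry, hψ, ?_⟩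
  rw [EquivLike.range_comp, ← he, Function.comp_apply, e.symm_apply_apply]

theorem ptGHDist_congr {X X' Y Y' : PtCpt.{u}} (hX : X ≈ X') (hY : Y ≈ Y') :
    ptGHDist X Y = ptGHDist X' Y' := by
  have h : ∀ {X X' Y : PtCpt.{u}}, X ≈ X' → couplingValues X Y = couplingValues X' Y := fun h =>
    (couplingValues_subset_of_isometry h).antisymm
      (couplingValues_subset_of_isometry (Setoid.symm h))
  unfold ptGHDist
  rw [h hX, couplingValues_comm X' Y, h hY, couplingValues_comm Y' X']

theorem ptGHDist_self (X : PtCpt.{u}) : ptGHDist X X = 0 := by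
  refine le_antisymm (csInf_le (couplingValues_bddBelow X X) ?_)
    (Real.sInf_nonneg fun _ h => couplingValues_nonneg h)
  exact ⟨X.carrier, inferInstance, inferInstance, id, id, isometry_id, isometry_id, by simp⟩

theorem ptGHDist_triangle (X Y Z : PtCpt.{u}) :
    ptGHDist X Z ≤ ptGHDist X Y + ptGHDist Y Z := by
  refine le_of_forall_pos_le_add fun ε hε => ?_
  obtain ⟨r, hr, hr'⟩ := Real.lt_sInf_add_pos (couplingValues_nonempty X Y) (half_pos hε)
  obtain ⟨s, hs, hs'⟩ := Real.lt_sInf_add_pos (couplingValues_nonempty Y Z) (half_pos hε)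
  suffices h : ptGHDist X Z ≤ r + s by
    change _ ≤ sInf _ + sInf _ + ε
    linarith
  obtain ⟨A, _, _, φ, ψ, hφ, hψ, rfl⟩ := hr
  obtain ⟨B, _, _, φ', ψ', hφ', hψ', rfl⟩ := hs
  have : Nonempty X.carrier := ⟨X.base⟩
  have : Nonempty Y.carrier := ⟨Y.base⟩
  have : Nonempty Z.carrier := ⟨Z.base⟩
  let L := Metric.toGlueL hψ hφ'
  let R := Metric.toGlueR hψ hφ'
  have hL : Isometry L := Metric.toGlueL_isometry hψ hφ'
  have hR : Isometry R := Metric.toGlueR_isometry hψ hφ'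
  have hLR : L ∘ ψ = R ∘ φ' := Metric.toGlue_commute hψ hφ'
  have hcpt : CompactSpace (Metric.GlueSpace hψ hφ') := by
    refine ⟨?_⟩
    have : (Set.univ : Set (Metric.GlueSpace hψ hφ')) = Set.range L ∪ Set.range R := by
      refine (Set.eq_univ_of_forall fun z => ?_).symm
      obtain ⟨w, rfl⟩ := Quotient.exists_rep z
      rcases w with a | b
      · exact Or.inl ⟨a, rfl⟩
      · exact Or.inr ⟨b, rfl⟩
    rw [this]
    exact (isCompact_range hL.continuous).union (isCompact_range hR.continuous)
  refine (csInf_le (couplingValues_bddBelow X Z) ⟨Metric.GlueSpace hψ hφ', inferInstance, hcpt,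
    L ∘ φ, R ∘ ψ', hL.comp hφ, hR.comp hψ', rfl⟩).trans ?_
  have hbd : ∀ {W : Type u} [MetricSpace W] [CompactSpace W] (s t : Set W), s.Nonempty →
      t.Nonempty → Metric.hausdorffEDist s t ≠ ⊤ := fun s t hs ht =>
    Metric.hausdorffEDist_ne_top_of_nonempty_of_bounded hs ht
      (Bornology.IsBounded.all s) (Bornology.IsBounded.all t)
  apply max_le
  · have h1 := Metric.hausdorffDist_triangle (u := Set.range (R ∘ ψ'))
      (hbd (Set.range (L ∘ φ)) (Set.range (L ∘ ψ)) (Set.range_nonempty _) (Set.range_nonempty _))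
    rw [Set.range_comp L φ, Set.range_comp L ψ, Metric.hausdorffDist_image hL, ← Set.range_comp L ψ,
      hLR, Set.range_comp R φ', Set.range_comp R ψ', Metric.hausdorffDist_image hR] at h1
    rw [Set.range_comp L φ, Set.range_comp R ψ']
    exact h1.trans (add_le_add (le_max_left _ _) (le_max_left _ _))
  · have h1 := dist_triangle (L (φ X.base)) (L (ψ Y.base)) (R (ψ' Z.base))
    rw [hL.dist_eq, show L (ψ Y.base) = R (φ' Y.base) from congrFun hLR _, hR.dist_eq] at h1
    exact h1.trans (add_le_add (le_max_right _ _) (le_max_right _ _))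

/-- Almost isometric, almost surjective maps provided by an almost optimal coupling. -/
theorem exists_approx_of_ptGHDist {X Y : PtCpt.{u}} {ε : ℝ} (h : ptGHDist X Y < ε) :
    ∃ (f : X.carrier → Y.carrier) (g : Y.carrier → X.carrier),
      (∀ x x', |dist (f x) (f x') - dist x x'| ≤ 2 * ε) ∧ dist (f X.base) Y.base ≤ 2 * ε ∧
      ∀ y, dist (f (g y)) y ≤ 2 * ε := by
  obtain ⟨r, hr, hrε⟩ := (csInf_lt_iff (couplingValues_bddBelow X Y)
    (couplingValues_nonempty X Y)).1 h
  obtain ⟨Z, _, _, φ, ψ, hφ, hψ, rfl⟩ := hr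
  have : Nonempty X.carrier := ⟨X.base⟩
  have : Nonempty Y.carrier := ⟨Y.base⟩
  rw [max_lt_iff] at hrε
  have hfin : Metric.hausdorffEDist (Set.range φ) (Set.range ψ) ≠ ⊤ :=
    Metric.hausdorffEDist_ne_top_of_nonempty_of_bounded (Set.range_nonempty _)
      (Set.range_nonempty _) (Bornology.IsBounded.all _) (Bornology.IsBounded.all _)
  have hf : ∀ x, ∃ y, dist (φ x) (ψ y) < ε := fun x => by
    obtain ⟨_, ⟨y, rfl⟩, hy⟩ := Metric.exists_dist_lt_of_hausdorffDist_lt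
      (Set.mem_range_self x) hrε.1 hfin
    exact ⟨y, hy⟩
  have hg : ∀ y, ∃ x, dist (φ x) (ψ y) < ε := fun y => by
    obtain ⟨_, ⟨x, rfl⟩, hx⟩ := Metric.exists_dist_lt_of_hausdorffDist_lt'
      (Set.mem_range_self y) hrε.1 hfin
    exact ⟨x, hx⟩
  choose f hf using hf
  choose g hg using hg
  refine ⟨f, g, fun x x' => ?_, ?_, fun y => ?_⟩
  · rw [← hφ.dist_eq, ← hψ.dist_eq, abs_le]
    have h1 := dist_triangle4 (ψ (f x)) (φ x) (φ x') (ψ (f x'))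
    have h2 := dist_triangle4 (φ x) (ψ (f x)) (ψ (f x')) (φ x')
    rw [dist_comm (ψ (f x)) (φ x)] at h1
    rw [dist_comm (ψ (f x')) (φ x')] at h2
    constructor <;> linarith [hf x, hf x']
  · rw [← hψ.dist_eq]
    have h1 := dist_triangle_left (ψ (f X.base)) (ψ Y.base) (φ X.base)
    linarith [hf X.base]
  · rw [← hψ.dist_eq]
    have h1 := dist_triangle_left (ψ (f (g y))) (ψ y) (φ (g y))
    linarith [hf (g y), hg y]

theorem isometric_of_ptGHDist_eq_zero {X Y : PtCpt.{u}} (h : ptGHDist X Y = 0) : X ≈ Y := by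
  let ε : ℕ → ℝ := fun n => 1 / ((n : ℝ) + 1)
  have hε : ∀ n, 0 < ε n := fun n => Nat.one_div_pos_of_nat
  have hε0 : Tendsto (fun n => 2 * ε n) (hyperfilter ℕ) (𝓝 0) := by
    have := (tendsto_one_div_add_atTop_nhds_zero_nat (𝕜 := ℝ)).const_mul 2
    rw [mul_zero] at this
    exact this.mono_left Nat.hyperfilter_le_atTop
  choose f g hf hf0 hfg using fun n => exists_approx_of_ptGHDist (h.trans_lt (hε n))
  have hlim : ∀ {W : Type u} [MetricSpace W] [CompactSpace W] (w : ℕ → W),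
      ∃ a, Tendsto w (hyperfilter ℕ) (𝓝 a) := fun {W} _ _ w =>
    ⟨((hyperfilter ℕ).map w).lim, ((hyperfilter ℕ).map w).le_nhds_lim⟩
  choose F hF using fun x => hlim fun n => f n x
  have hFiso : Isometry F := by
    refine Isometry.of_dist_eq fun x x' => ?_
    refine tendsto_nhds_unique ((hF x).dist (hF x')) ?_
    rw [tendsto_iff_dist_tendsto_zero]
    exact squeeze_zero (fun _ => dist_nonneg) (fun n => hf n x x') hε0
  have hFsurj : Function.Surjective F := by
    intro y
    obtain ⟨x, hx⟩ := hlim fun n => g n y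
    refine ⟨x, tendsto_nhds_unique (hF x) ?_⟩
    rw [tendsto_iff_dist_tendsto_zero]
    have hx' : Tendsto (fun n => dist x (g n y) + 2 * ε n + 2 * ε n) (hyperfilter ℕ) (𝓝 0) := by
      have := ((tendsto_const_nhds (x := x)).dist hx).add hε0 |>.add hε0
      simpa using this
    refine squeeze_zero (fun _ => dist_nonneg) (fun n => ?_) hx'
    have h1 := dist_triangle (f n x) (f n (g n y)) y
    have h2 := (abs_le.1 (hf n x (g n y))).2
    linarith [hfg n y]
  refine ⟨IsometryEquiv.mk (Equiv.ofBijective F ⟨hFiso.injective, hFsurj⟩) hFiso, ?_⟩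
  change F X.base = Y.base
  refine tendsto_nhds_unique (hF X.base) ?_
  rw [tendsto_iff_dist_tendsto_zero]
  exact squeeze_zero (fun _ => dist_nonneg) hf0 hε0

/-- The pointed Gromov-Hausdorff metric on `𝓗₀`. -/
noncomputable instance PtGHSpace.metricSpace : MetricSpace PtGHSpace.{u} where
  dist := Quotient.lift₂ ptGHDist fun _ _ _ _ h h' => ptGHDist_congr h h'
  dist_self := by
    rintro ⟨X⟩
    exact ptGHDist_self X
  dist_comm := by
    rintro ⟨X⟩ ⟨Y⟩
    exact congrArg sInf (couplingValues_comm X Y)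
  dist_triangle := by
    rintro ⟨X⟩ ⟨Y⟩ ⟨Z⟩
    exact ptGHDist_triangle X Y Z
  eq_of_dist_eq_zero := by
    rintro ⟨X⟩ ⟨Y⟩ h
    exact Quotient.sound (isometric_of_ptGHDist_eq_zero h)

theorem PtGHSpace.dist_mk (X Y : PtCpt.{u}) :
    dist (PtGHSpace.mk X) (PtGHSpace.mk Y) = ptGHDist X Y := rfl

/-- The natural projection `𝓗₀ → 𝓜₀/∼`. -/
def PtGHSpace.toMSpace : PtGHSpace.{u} → MSpace.{u} :=
  Quotient.lift (fun X => MSpace.mk X.toPtEMet) fun _ _ ⟨e, he⟩ =>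
    Quotient.sound ⟨Precsim.of_isometry e e.isometry he,
      Precsim.of_isometry e.symm e.symm.isometry ((e.symm_apply_eq).2 he.symm)⟩

theorem PtGHSpace.toMSpace_mk (X : PtCpt.{u}) :
    (PtGHSpace.mk X).toMSpace = MSpace.mk X.toPtEMet := rfl

/-! ### The pseudometric `ρ` -/

/-- The pointed pyramid `𝓟_X ⊆ 𝓗₀` of a pointed extended metric space `X`: the classes of the
pointed compact metric spaces `Y` with `Y ≾ X`. -/
def pyramid (X : PtEMet.{u}) : Set PtGHSpace.{u} :=
  PtGHSpace.mk '' {Y | Precsim Y.toPtEMet X}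

/-- `𝓗₀(N, D)`: the classes of pointed metric spaces with at most `N` points and diameter at
most `D`. -/
def finiteSpaces (N : ℕ) (D : ℝ) : Set PtGHSpace.{u} :=
  PtGHSpace.mk '' {Y | ENat.card Y.carrier ≤ N ∧ Metric.diam (Set.univ : Set Y.carrier) ≤ D}

/-- `ρ_N`: the Hausdorff distance, for the pointed Gromov-Hausdorff metric, between the parts of two
pyramids in `𝓗₀(N, N)`. -/
noncomputable def rhoN (N : ℕ) (X Y : PtEMet.{u}) : ℝ≥0∞ :=
  Metric.hausdorffEDist (pyramid X ∩ finiteSpaces N N) (pyramid Y ∩ finiteSpaces N N)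

/-- `ρ = ∑_{N ≥ 1} 2^{-N} ρ_N`. -/
noncomputable def rho (X Y : PtEMet.{u}) : ℝ≥0∞ :=
  ∑' n : ℕ, (2⁻¹ : ℝ≥0∞) ^ (n + 1) * rhoN (n + 1) X Y

/-! ### Pointed ultralimits -/

/-- The product of a sequence of extended metric spaces, carrying the pseudometric
`lim_U d(x_n, y_n) ∈ [0, ∞]`. -/
def UltraProd (_U : Ultrafilter ℕ) (X : ℕ → PtEMet.{u}) : Type u := ∀ n, (X n).carrier

/-- The limit in `[0, ∞]` of the distances `d(x_n, y_n)` along the ultrafilter `U`. -/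
noncomputable def ultraEDist (U : Ultrafilter ℕ) (X : ℕ → PtEMet.{u})
    (x y : ∀ n, (X n).carrier) : ℝ≥0∞ :=
  (U.map fun n => edist (x n) (y n)).lim

theorem tendsto_ultraEDist (U : Ultrafilter ℕ) (X : ℕ → PtEMet.{u})
    (x y : ∀ n, (X n).carrier) :
    Tendsto (fun n => edist (x n) (y n)) U (𝓝 (ultraEDist U X x y)) :=
  (U.map fun n => edist (x n) (y n)).le_nhds_lim

noncomputable instance UltraProd.pseudoEMetricSpace (U : Ultrafilter ℕ) (X : ℕ → PtEMet.{u}) :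
    PseudoEMetricSpace (UltraProd U X) where
  edist x y := ultraEDist U X x y
  edist_self x := tendsto_nhds_unique (tendsto_ultraEDist U X x x) (by simp)
  edist_comm x y := tendsto_nhds_unique (tendsto_ultraEDist U X x y) (by
    simpa only [edist_comm] using tendsto_ultraEDist U X y x)
  edist_triangle x y z := le_of_tendsto_of_tendsto' (tendsto_ultraEDist U X x z)
    ((tendsto_ultraEDist U X x y).add (tendsto_ultraEDist U X y z)) fun _ => edist_triangle _ _ _

/-- The pointed ultralimit along `U` of a sequence of pointed extended metric spaces: the quotient
of the product that identifies points at distance zero, with base point the class of the sequence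
of base points. -/
noncomputable def ultralimit (U : Ultrafilter ℕ) (X : ℕ → PtEMet.{u}) : PtEMet.{u} where
  carrier := SeparationQuotient (UltraProd U X)
  base := SeparationQuotient.mk (X := UltraProd U X) fun n => (X n).base

/-! ### Couplings -/

/-! A pyramid is read off from finite data. By the Fréchet embedding, a pointed space with at most
`n + 1` points and diameter at most `n + 1` is the range of a tuple in a compact cube
(`image_tupleClass_cube`), and the tuples dominated by `X` form a compact subset
(`isCompact_tuplesBelow`). Domination of a finite space means realising its distances in `X` up to
every factor `t < 1` (`rangeSpace_precsim_iff`), so replacing `q` by `t • q` turns approximate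
domination into exact domination at small cost. As `tupleClass` is 1-Lipschitz, upper bounds for
`ρ_N` can be proved on tuples.

If `ρ` vanishes, the finite parts agree, being closed; truncated finite subspaces then recover `≾`.
The same subspaces converge to `X`, which gives density. For the Lipschitz bound, a tuple dominated
by `X` is a 1-Lipschitz function on part of a coupling; it is extended and evaluated at nearby
points of `Y`.

The central fact is `tendsto_rho_ultralimit`: along any ultrafilter a sequence `ρ`-converges to its
ultralimit. Compactness follows, and so does the ultralimit statement, by uniqueness of limits. For
the embedding, if compact `X n` converge to a compact `Y` in `ρ`, their ultralimit is equivalent to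
`Y`, hence a dense subspace of it by rigidity of compact spaces under noncontracting maps
(`exists_isometry_denseRange`). A finite net of `Y` then lifts to nets of the `X n`
(`eventually_ptGHDist_le`). -/

theorem ptGHDist_le_of_isometry {X Y : PtCpt.{u}} {W : Type u} [MetricSpace W]
    {φ : X.carrier → W} {ψ : Y.carrier → W} (hφ : Isometry φ) (hψ : Isometry ψ) {r : ℝ}
    (h₁ : ∀ x, ∃ y, dist (φ x) (ψ y) ≤ r) (h₂ : ∀ y, ∃ x, dist (φ x) (ψ y) ≤ r)
    (h₀ : dist (φ X.base) (ψ Y.base) ≤ r) : ptGHDist X Y ≤ r := by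
  let Z : Set W := Set.range φ ∪ Set.range ψ
  have hZ : CompactSpace Z := isCompact_iff_compactSpace.1
    ((isCompact_range hφ.continuous).union (isCompact_range hψ.continuous))
  let φ' : X.carrier → Z := fun x => ⟨φ x, Or.inl ⟨x, rfl⟩⟩
  let ψ' : Y.carrier → Z := fun y => ⟨ψ y, Or.inr ⟨y, rfl⟩⟩
  refine (csInf_le (couplingValues_bddBelow X Y) ⟨Z, inferInstance, hZ, φ', ψ',
    fun x y => hφ x y, fun x y => hψ x y, rfl⟩).trans (max_le ?_ h₀)
  refine Metric.hausdorffDist_le_of_mem_dist (dist_nonneg.trans h₀) ?_ ?_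
  · rintro _ ⟨x, rfl⟩
    obtain ⟨y, hy⟩ := h₁ x
    exact ⟨_, ⟨y, rfl⟩, hy⟩
  · rintro _ ⟨y, rfl⟩
    obtain ⟨x, hx⟩ := h₂ y
    refine ⟨_, ⟨x, rfl⟩, ?_⟩
    rw [dist_comm]
    exact hx

/-- Two compact spaces with almost isometric nets are close. -/
theorem ptGHDist_le_of_nets {X Y : PtCpt.{u}} {ι : Type*} (x : ι → X.carrier) (y : ι → Y.carrier)
    (i₀ : ι) (hx₀ : x i₀ = X.base) (hy₀ : y i₀ = Y.base) {ε : ℝ} (hε : 0 < ε)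
    (hx : ∀ a, ∃ i, dist a (x i) ≤ ε) (hy : ∀ b, ∃ i, dist b (y i) ≤ ε)
    (h : ∀ i j, |dist (x i) (x j) - dist (y i) (y j)| ≤ 2 * ε) : ptGHDist X Y ≤ 2 * ε := by
  have : Nonempty ι := ⟨i₀⟩
  -- Matched net points are glued at distance `ε`, which the distortion bound permits. Going to the
  -- net costs at most `ε`, crossing over another `ε`.
  let _ : MetricSpace (X.carrier ⊕ Y.carrier) := Metric.glueMetricApprox x y ε hε h
  have hl : Isometry (Sum.inl : X.carrier → X.carrier ⊕ Y.carrier) := Isometry.of_dist_eq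
    fun _ _ => rfl
  have hr : Isometry (Sum.inr : Y.carrier → X.carrier ⊕ Y.carrier) := Isometry.of_dist_eq
    fun _ _ => rfl
  have hg : ∀ i, dist (Sum.inl (x i) : X.carrier ⊕ Y.carrier) (Sum.inr (y i)) = ε := fun i =>
    Metric.glueDist_glued_points x y ε i
  refine ptGHDist_le_of_isometry hl hr (fun a => ?_) (fun b => ?_) ?_
  · obtain ⟨i, hi⟩ := hx a
    refine ⟨y i, (dist_triangle _ (Sum.inl (x i)) _).trans ?_⟩
    rw [hg, hl.dist_eq]
    linarith
  · obtain ⟨i, hi⟩ := hy b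
    refine ⟨x i, (dist_triangle _ (Sum.inr (y i)) _).trans ?_⟩
    rw [hg, hr.dist_eq, dist_comm]
    linarith
  · rw [← hx₀, ← hy₀, hg]
    linarith

/-! ### The relation `≾` -/

theorem Precsim.exists_finite {X Y : PtEMet.{u}} (h : Precsim X Y) {ι : Type*} [Finite ι]
    (x : ι → X.carrier) (i₀ : ι) (hx : x i₀ = X.base) (c : ι → ι → ℝ≥0∞)
    (hc : ∀ i j, c i j = 0 ∨ c i j < edist (x i) (x j)) :
    ∃ y : ι → Y.carrier, y i₀ = Y.base ∧ ∀ i j, c i j ≤ edist (y i) (y j) := by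
  obtain ⟨m, ⟨e⟩⟩ := Finite.exists_equiv_fin ι
  obtain ⟨N, rfl⟩ : ∃ N, m = N + 1 := ⟨m - 1, by have := (e i₀).pos; omega⟩
  -- The swap moves the base index to `0`.
  let e' := e.trans (Equiv.swap (e i₀) 0)
  have he : e' i₀ = 0 := by simp [e']
  have he' : e'.symm 0 = i₀ := by rw [← he, e'.symm_apply_apply]
  obtain ⟨y, hy0, hy⟩ := (precsim_iff X Y).1 h N (x ∘ e'.symm) (by simp [he', hx])
    (fun i j => c (e'.symm i) (e'.symm j)) fun i j => hc _ _
  refine ⟨y ∘ e', by simp [he, hy0], fun i j => ?_⟩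
  by_cases hij : i = j
  · subst hij
    rcases hc i i with h | h
    · simp [h]
    · simp at h
  · simpa using hy (e' i) (e' j) (e'.injective.ne hij)

/-- Only finitely many strict inequalities are tested at a time, and these survive a small additive
error. -/
theorem precsim_of_approx {X Y : PtEMet.{u}}
    (h : ∀ ε : ℝ≥0∞, 0 < ε → ∃ f : X.carrier → Y.carrier, f X.base = Y.base ∧
      ∀ x x', edist x x' ≤ edist (f x) (f x') + ε) : Precsim X Y := by
  rw [precsim_iff]
  intro N x hx c hc
  have key : ∀ᶠ ε in 𝓝[>] (0 : ℝ≥0∞), ∀ i j, c i j = 0 ∨ c i j + ε < edist (x i) (x j) := by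
    refine eventually_all.2 fun i => eventually_all.2 fun j => ?_
    rcases hc i j with h | h
    · simp [h]
    · have : Tendsto (fun ε => c i j + ε) (𝓝[>] (0 : ℝ≥0∞)) (𝓝 (c i j + 0)) :=
        (tendsto_const_nhds.add tendsto_id).mono_left nhdsWithin_le_nhds
      rw [add_zero] at this
      exact (this.eventually_lt_const h).mono fun _ => Or.inr
  obtain ⟨ε, hε, hε0⟩ := (key.and self_mem_nhdsWithin).exists
  obtain ⟨f, hf0, hf⟩ := h ε hε0
  refine ⟨fun i => f (x i), by simp only [hx, hf0], fun i j _ => ?_⟩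
  rcases hε i j with h | h
  · simp [h]
  · exact (lt_of_add_lt_add_right (h.trans_le (hf _ _))).le

/-! ### Finite spaces as tuples -/

/-- The range of a nonempty tuple in a metric space, with base point the first entry. -/
def rangeSpace {W : Type u} [MetricSpace W] {n : ℕ} (q : Fin (n + 1) → W) : PtCpt.{u} where
  carrier := Set.range q
  base := ⟨q 0, 0, rfl⟩

/-- The distances in the range are finite, so lower bounds strictly below them can be taken of the
form `t * d` with one common `t < 1`. Repeated entries of `q` impose no condition. -/
theorem rangeSpace_precsim_iff {W : Type u} [MetricSpace W] {n : ℕ} {q : Fin (n + 1) → W}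
    {X : PtEMet.{u}} : Precsim (rangeSpace q).toPtEMet X ↔
      ∀ t : ℝ≥0∞, t < 1 → ∃ x : Fin (n + 1) → X.carrier, x 0 = X.base ∧
        ∀ i j, t * edist (q i) (q j) ≤ edist (x i) (x j) := by
  constructor
  · intro h t ht
    refine h.exists_finite (fun i => (⟨q i, i, rfl⟩ : Set.range q)) 0 rfl _ fun i j => ?_
    by_cases hij : q i = q j
    · simp [hij]
    · right
      change _ < edist (q i) (q j)
      have h0 : edist (q i) (q j) ≠ 0 := by simpa using hij
      simpa using ENNReal.mul_lt_mul_left h0 (edist_ne_top _ _) ht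
  · intro h
    rw [precsim_iff]
    intro N z hz c hc
    -- Entries of `q` may repeat, and only `x 0` is known to be the base point, so index `0` must be
    -- chosen for `z 0`.
    have hidx : ∀ k, ∃ i, q i = (z k : Set.range q).1 ∧ (k = 0 → i = 0) := by
      intro k
      by_cases hk : k = 0
      · subst hk
        exact ⟨0, by rw [hz]; rfl, fun _ => rfl⟩
      · obtain ⟨i, hi⟩ := (z k : Set.range q).2
        exact ⟨i, hi, fun h => absurd h hk⟩
    choose idx hq hidx0 using hidx
    have key : ∀ᶠ t in 𝓝[<] (1 : ℝ≥0∞), ∀ a b, c a b ≤ t * edist (q (idx a)) (q (idx b)) := by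
      refine eventually_all.2 fun a => eventually_all.2 fun b => ?_
      rcases hc a b with h | h
      · simp [h]
      · replace h : c a b < edist (z a : Set.range q).1 (z b : Set.range q).1 := h
        rw [← hq, ← hq] at h
        have : Tendsto (fun t => t * edist (q (idx a)) (q (idx b))) (𝓝[<] (1 : ℝ≥0∞))
            (𝓝 (1 * edist (q (idx a)) (q (idx b)))) :=
          ENNReal.Tendsto.mul_const (tendsto_id.mono_left nhdsWithin_le_nhds) (by simp)
        rw [one_mul] at this
        exact (this.eventually_const_lt h).mono fun _ h => h.le
    have : (𝓝[<] (1 : ℝ≥0∞)).NeBot := nhdsLT_neBot_of_exists_lt ⟨0, by simp⟩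
    obtain ⟨t, ht, ht1⟩ := (key.and self_mem_nhdsWithin).exists
    obtain ⟨x, hx0, hx⟩ := h t ht1
    exact ⟨x ∘ idx, by simp [hidx0 0 rfl, hx0], fun a b _ => (ht a b).trans (hx _ _)⟩

theorem rangeSpace_precsim_of_le {W : Type u} [MetricSpace W] {n : ℕ} {q : Fin (n + 1) → W}
    {X : PtEMet.{u}} (x : Fin (n + 1) → X.carrier) (hx : x 0 = X.base)
    (h : ∀ i j, edist (q i) (q j) ≤ edist (x i) (x j)) : Precsim (rangeSpace q).toPtEMet X :=
  rangeSpace_precsim_iff.2 fun _ ht => ⟨x, hx, fun i j =>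
    (mul_le_of_le_one_left zero_le ht.le).trans (h i j)⟩

theorem ptGHDist_rangeSpace_le {W : Type u} [MetricSpace W] {n : ℕ} (q q' : Fin (n + 1) → W) :
    ptGHDist (rangeSpace q) (rangeSpace q') ≤ dist q q' := by
  refine ptGHDist_le_of_isometry (X := rangeSpace q) (Y := rangeSpace q') (W := W)
    (φ := Subtype.val) (ψ := Subtype.val) isometry_subtype_coe isometry_subtype_coe ?_ ?_
    (dist_le_pi_dist q q' 0)
  · rintro ⟨_, i, rfl⟩
    exact ⟨⟨q' i, i, rfl⟩, dist_le_pi_dist q q' i⟩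
  · rintro ⟨_, i, rfl⟩
    exact ⟨⟨q i, i, rfl⟩, dist_le_pi_dist q q' i⟩

/-- Tuples of `n + 1` points of `ℝ^(n + 1)` with the supremum norm. -/
abbrev Tuples (n : ℕ) : Type u := Fin (n + 1) → ULift.{u} (Fin (n + 1)) → ℝ

/-- The tuples with entries in `[0, n + 1]`. -/
def cube (n : ℕ) : Set (Tuples.{u} n) :=
  Set.univ.pi fun _ => Set.univ.pi fun _ => Set.Icc 0 ((n + 1 : ℕ) : ℝ)

theorem mem_cube {n : ℕ} {q : Tuples.{u} n} :
    q ∈ cube n ↔ ∀ i k, 0 ≤ q i k ∧ q i k ≤ ((n + 1 : ℕ) : ℝ) := by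
  simp only [cube, Set.mem_pi, Set.mem_univ, true_imp_iff, Set.mem_Icc]

theorem isCompact_cube (n : ℕ) : IsCompact (cube.{u} n) :=
  isCompact_univ_pi fun _ => isCompact_univ_pi fun _ => isCompact_Icc

theorem dist_le_of_mem_cube {n : ℕ} {q q' : Tuples.{u} n} (hq : q ∈ cube n) (hq' : q' ∈ cube n)
    (i j : Fin (n + 1)) : dist (q i) (q' j) ≤ ((n + 1 : ℕ) : ℝ) := by
  refine (dist_pi_le_iff (by positivity)).2 fun k => ?_
  rw [mem_cube] at hq hq'
  rw [Real.dist_eq, abs_le]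
  constructor <;> linarith [hq i k, hq' j k]

/-- The class of the range of a tuple. -/
def tupleClass {n : ℕ} (q : Tuples.{u} n) : PtGHSpace.{u} := PtGHSpace.mk (rangeSpace q)

theorem lipschitzWith_tupleClass (n : ℕ) : LipschitzWith 1 (tupleClass.{u} (n := n)) :=
  LipschitzWith.of_dist_le_mul fun q q' => by
    simpa using! ptGHDist_rangeSpace_le q q'

/-- Every such space is listed, with repetitions and base point first, by some `p`, and `y ↦ (d(y, p
k))` embeds it isometrically in the sup norm; the diameter bound keeps the coordinates in the cube.
-/
theorem image_tupleClass_cube (n : ℕ) :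
    tupleClass '' cube.{u} n = finiteSpaces (n + 1) ((n + 1 : ℕ) : ℝ) := by
  apply Set.Subset.antisymm
  · rintro _ ⟨q, hq, rfl⟩
    refine ⟨rangeSpace q, ⟨?_, ?_⟩, rfl⟩
    · change ENat.card (Set.range q) ≤ _
      rw [ENat.card_eq_coe_natCard]
      have := Finite.card_range_le q
      rw [Nat.card_eq_fintype_card (α := Fin _), Fintype.card_fin] at this
      exact_mod_cast this
    · refine Metric.diam_le_of_forall_dist_le (by positivity) ?_
      rintro ⟨_, i, rfl⟩ - ⟨_, j, rfl⟩ -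
      exact dist_le_of_mem_cube hq hq i j
  · rintro _ ⟨Y, ⟨hc, hd⟩, rfl⟩
    have hfin : Finite Y.carrier := by
      rw [← ENat.card_lt_top]
      exact hc.trans_lt (ENat.natCast_lt_top _)
    rw [ENat.card_eq_coe_natCard] at hc
    have hc' : Nat.card Y.carrier ≤ n + 1 := by exact_mod_cast hc
    obtain ⟨p, hp, hp0⟩ : ∃ p : Fin (n + 1) → Y.carrier, Function.Surjective p ∧ p 0 = Y.base := by
      obtain ⟨e⟩ := Finite.equivFin Y.carrier |> Nonempty.intro
      let g : Y.carrier → Fin (n + 1) := fun y =>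
        Equiv.swap (Fin.castLE hc' (e Y.base)) 0 (Fin.castLE hc' (e y))
      have hg : Function.Injective g :=
        (Equiv.injective _).comp ((Fin.castLE_injective hc').comp e.injective)
      have : Nonempty Y.carrier := ⟨Y.base⟩
      refine ⟨Function.invFun g, Function.invFun_surjective hg, ?_⟩
      have : g Y.base = 0 := by simp [g]
      rw [← this, Function.leftInverse_invFun hg]
    have hdist : ∀ y y' : Y.carrier, dist y y' ≤ ((n + 1 : ℕ) : ℝ) := fun y y' =>
      (Metric.dist_le_diam_of_mem (Bornology.IsBounded.all _) (Set.mem_univ y)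
        (Set.mem_univ y')).trans hd
    let κ : Y.carrier → ULift.{u} (Fin (n + 1)) → ℝ := fun y k => dist y (p k.down)
    have hκ : Isometry κ := by
      refine Isometry.of_dist_eq fun y y' => le_antisymm ?_ ?_
      · refine (dist_pi_le_iff dist_nonneg).2 fun k => ?_
        simpa [κ, Real.dist_eq, dist_comm] using abs_dist_sub_le y y' (p k.down)
      -- The coordinate belonging to `y'` attains the distance.
      · obtain ⟨k, rfl⟩ := hp y'
        refine le_trans ?_ (dist_le_pi_dist _ _ ⟨k⟩)
        simp [κ]
    refine ⟨fun i => κ (p i), mem_cube.2 fun i k => ⟨dist_nonneg, hdist _ _⟩, ?_⟩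
    refine Quotient.sound (Setoid.symm ⟨?_, ?_⟩)
    · refine IsometryEquiv.mk (Equiv.ofBijective (fun y => ⟨κ y, ?_⟩) ⟨?_, ?_⟩) ?_
      · obtain ⟨i, rfl⟩ := hp y
        exact ⟨i, rfl⟩
      · intro y y' h
        exact hκ.injective (congrArg Subtype.val h)
      · rintro ⟨_, i, rfl⟩
        exact ⟨p i, rfl⟩
      · exact fun y y' => hκ y y'
    · exact Subtype.ext (congrArg κ hp0.symm)

/-! ### Domination and membership in pyramids -/

theorem precsim_of_le {X Y : PtEMet.{u}} (f : X.carrier → Y.carrier) (h₀ : f X.base = Y.base)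
    (h : ∀ x x', edist x x' ≤ edist (f x) (f x')) : Precsim X Y :=
  precsim_of_approx fun _ _ => ⟨f, h₀, fun x x' => (h x x').trans le_self_add⟩

theorem PtCpt.precsim_of_equiv {X Y : PtCpt.{u}} (h : X ≈ Y) : Precsim X.toPtEMet Y.toPtEMet := by
  obtain ⟨e, he⟩ := h
  exact Precsim.of_isometry e e.isometry he

theorem mk_mem_pyramid {X : PtEMet.{u}} {Y : PtCpt.{u}} :
    PtGHSpace.mk Y ∈ pyramid X ↔ Precsim Y.toPtEMet X := by
  refine ⟨?_, fun h => ⟨Y, h, rfl⟩⟩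
  rintro ⟨Z, hZ, h⟩
  exact (PtCpt.precsim_of_equiv (Setoid.symm (Quotient.exact h))).trans hZ

theorem pyramid_mono {X Y : PtEMet.{u}} (h : Precsim X Y) : pyramid X ⊆ pyramid Y := by
  rintro _ ⟨Z, hZ, rfl⟩
  exact ⟨Z, Precsim.trans hZ h, rfl⟩

/-! ### The finite parts of a pyramid -/

/-- The tuples in the cube whose class lies in the pyramid of `X`. -/
def tuplesBelow (n : ℕ) (X : PtEMet.{u}) : Set (Tuples.{u} n) :=
  {q | q ∈ cube n ∧ Precsim (rangeSpace q).toPtEMet X}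

theorem image_tuplesBelow (n : ℕ) (X : PtEMet.{u}) :
    tupleClass '' tuplesBelow n X = pyramid X ∩ finiteSpaces (n + 1) ((n + 1 : ℕ) : ℝ) := by
  rw [← image_tupleClass_cube]
  apply Set.Subset.antisymm
  · rintro _ ⟨q, ⟨hq, h⟩, rfl⟩
    exact ⟨⟨_, h, rfl⟩, q, hq, rfl⟩
  · rintro _ ⟨h, q, hq, rfl⟩
    exact ⟨q, ⟨hq, mk_mem_pyramid.1 h⟩, rfl⟩

/-- The zero tuple is the one-point space, a common element of all finite parts and a default value
in later choices. -/
theorem zero_mem_tuplesBelow (n : ℕ) (X : PtEMet.{u}) : 0 ∈ tuplesBelow n X :=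
  ⟨mem_cube.2 fun _ _ => ⟨le_rfl, Nat.cast_nonneg _⟩,
    rangeSpace_precsim_of_le (fun _ => X.base) rfl fun _ _ => by simp⟩

/-- The slack is split at `t < s < 1`: domination of `p a` is used with factor `s`, and the gap from
`t` to `s` absorbs the convergence `p a → q`. It serves both for a fixed `X` (closedness) and for
varying spaces (ultralimits). -/
theorem eventually_exists_of_tendsto {α : Type*} {l : Filter α} {n : ℕ} {p : α → Tuples.{u} n}
    {q : Tuples.{u} n} (hp : Tendsto p l (𝓝 q)) {X : α → PtEMet.{u}}
    (h : ∀ᶠ a in l, Precsim (rangeSpace (p a)).toPtEMet (X a)) {t : ℝ≥0∞} (ht : t < 1) :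
    ∀ᶠ a in l, ∃ x : Fin (n + 1) → (X a).carrier, x 0 = (X a).base ∧
      ∀ i j, t * edist (q i) (q j) ≤ edist (x i) (x j) := by
  obtain ⟨s, hts, hs⟩ := exists_between ht
  have key : ∀ᶠ a in l, ∀ i j, t * edist (q i) (q j) ≤ s * edist (p a i) (p a j) := by
    refine eventually_all.2 fun i => eventually_all.2 fun j => ?_
    by_cases hij : q i = q j
    · simp [hij]
    · have h0 : edist (q i) (q j) ≠ 0 := by simpa using hij
      have hlt : t * edist (q i) (q j) < s * edist (q i) (q j) :=
        ENNReal.mul_lt_mul_left h0 (edist_ne_top _ _) hts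
      have hlim : Tendsto (fun a => s * edist (p a i) (p a j)) l (𝓝 (s * edist (q i) (q j))) :=
        ENNReal.Tendsto.const_mul ((tendsto_pi_nhds.1 hp i).edist (tendsto_pi_nhds.1 hp j))
          (Or.inr (hs.trans ENNReal.one_lt_top).ne)
      exact (hlim.eventually_const_lt hlt).mono fun _ h => h.le
  filter_upwards [key, h] with a ha hpa
  obtain ⟨x, hx0, hx⟩ := rangeSpace_precsim_iff.1 hpa s hs
  exact ⟨x, hx0, fun i j => (ha i j).trans (hx i j)⟩

theorem isCompact_tuplesBelow (n : ℕ) (X : PtEMet.{u}) : IsCompact (tuplesBelow n X) := by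
  refine (isCompact_cube n).of_isClosed_subset ?_ fun q hq => hq.1
  refine isClosed_of_closure_subset fun q hq => ?_
  refine ⟨(isCompact_cube n).isClosed.closure_subset_iff.2 (fun q hq => hq.1) hq, ?_⟩
  have := mem_closure_iff_nhdsWithin_neBot.1 hq
  refine rangeSpace_precsim_iff.2 fun t ht => ?_
  refine (eventually_exists_of_tendsto (l := 𝓝[tuplesBelow n X] q) (p := id) (X := fun _ => X)
    (tendsto_id.mono_left nhdsWithin_le_nhds) ?_ ht).exists.choose_spec
  filter_upwards [self_mem_nhdsWithin] with p hp using hp.2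

theorem smul_mem_cube {n : ℕ} {q : Tuples.{u} n} (hq : q ∈ cube n) {t : ℝ} (ht₀ : 0 ≤ t)
    (ht₁ : t ≤ 1) : t • q ∈ cube n := by
  rw [mem_cube] at *
  intro i k
  obtain ⟨h0, h1⟩ := hq i k
  exact ⟨mul_nonneg ht₀ h0, (mul_le_of_le_one_left h0 ht₁).trans h1⟩

theorem smul_mem_tuplesBelow {n : ℕ} {q : Tuples.{u} n} (hq : q ∈ cube n) {t : ℝ} (ht₀ : 0 ≤ t)
    (ht₁ : t ≤ 1) {X : PtEMet.{u}} (x : Fin (n + 1) → X.carrier) (hx₀ : x 0 = X.base)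
    (hx : ∀ i j, ENNReal.ofReal t * edist (q i) (q j) ≤ edist (x i) (x j)) :
    t • q ∈ tuplesBelow n X := by
  refine ⟨smul_mem_cube hq ht₀ ht₁, rangeSpace_precsim_of_le x hx₀ fun i j => ?_⟩
  rw [Pi.smul_apply, Pi.smul_apply, edist_smul₀,
    ENNReal.smul_def, smul_eq_mul]
  change ‖t‖ₑ * _ ≤ _
  rw [Real.enorm_eq_ofReal ht₀]
  exact hx i j

theorem exists_smul_near {E : Type*} [SeminormedAddCommGroup E] [NormedSpace ℝ E] (q : E)
    {ε : ℝ≥0∞} (hε : 0 < ε) : ∃ t : ℝ, 0 ≤ t ∧ t < 1 ∧ edist q (t • q) ≤ ε := by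
  have h : Tendsto (fun t : ℝ => edist q (t • q)) (𝓝[<] 1) (𝓝 (edist q ((1 : ℝ) • q))) :=
    (Continuous.tendsto (by fun_prop) 1).mono_left nhdsWithin_le_nhds
  rw [one_smul, edist_self] at h
  obtain ⟨t, h₁, h₂⟩ :=
    ((h.eventually_lt_const hε).and (Ioo_mem_nhdsLT (zero_lt_one' ℝ))).exists
  exact ⟨t, h₂.1.le, h₂.2, h₁.le⟩

/-! ### The metric `ρ` -/

theorem rhoN_succ_le {n : ℕ} {X Y : PtEMet.{u}} {r : ℝ≥0∞}
    (h₁ : ∀ q ∈ tuplesBelow n X, ∃ q' ∈ tuplesBelow n Y, edist q q' ≤ r)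
    (h₂ : ∀ q ∈ tuplesBelow n Y, ∃ q' ∈ tuplesBelow n X, edist q q' ≤ r) :
    rhoN (n + 1) X Y ≤ r := by
  rw [rhoN, ← image_tuplesBelow, ← image_tuplesBelow]
  refine Metric.hausdorffEDist_le_of_mem_edist ?_ ?_
  · rintro _ ⟨q, hq, rfl⟩
    obtain ⟨q', hq', h⟩ := h₁ q hq
    exact ⟨_, ⟨q', hq', rfl⟩, ((lipschitzWith_tupleClass n).edist_le_mul q q').trans (by simpa)⟩
  · rintro _ ⟨q, hq, rfl⟩
    obtain ⟨q', hq', h⟩ := h₂ q hq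
    exact ⟨_, ⟨q', hq', rfl⟩, ((lipschitzWith_tupleClass n).edist_le_mul q q').trans (by simpa)⟩

theorem rhoN_succ_le_natCast (n : ℕ) (X Y : PtEMet.{u}) :
    rhoN (n + 1) X Y ≤ ((n + 1 : ℕ) : ℝ≥0∞) := by
  have h : ∀ X Y : PtEMet.{u}, ∀ q ∈ tuplesBelow n X, ∃ q' ∈ tuplesBelow n Y,
      edist q q' ≤ ((n + 1 : ℕ) : ℝ≥0∞) := fun X Y q hq => by
    refine ⟨0, zero_mem_tuplesBelow n Y, ?_⟩
    rw [edist_dist, ← ENNReal.ofReal_natCast]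
    exact ENNReal.ofReal_le_ofReal ((dist_pi_le_iff (by positivity)).2 fun i =>
      dist_le_of_mem_cube hq.1 (zero_mem_tuplesBelow n Y).1 i i)
  exact rhoN_succ_le (h X Y) (h Y X)

theorem tsum_bound_ne_top :
    ∑' n : ℕ, (2⁻¹ : ℝ≥0∞) ^ (n + 1) * ((n + 1 : ℕ) : ℝ≥0∞) ≠ ∞ := by
  have h : Summable fun n : ℕ => ((n + 1 : ℕ) : ℝ) * (2⁻¹ : ℝ) ^ (n + 1) := by
    have := summable_pow_mul_geometric_of_norm_lt_one 1 (r := (2⁻¹ : ℝ)) (by norm_num)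
    simpa using (summable_nat_add_iff 1).2 this
  have h' : ∀ n : ℕ, (2⁻¹ : ℝ≥0∞) ^ (n + 1) * ((n + 1 : ℕ) : ℝ≥0∞) =
      ENNReal.ofReal (((n + 1 : ℕ) : ℝ) * (2⁻¹ : ℝ) ^ (n + 1)) := fun n => by
    rw [ENNReal.ofReal_mul (by positivity), ENNReal.ofReal_natCast,
      ENNReal.ofReal_pow (by positivity), ENNReal.ofReal_inv_of_pos (by positivity), mul_comm]
    simp
  simp_rw [h']
  exact h.tsum_ofReal_ne_top

theorem rho_ne_top (X Y : PtEMet.{u}) : rho X Y ≠ ∞ :=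
  ne_top_of_le_ne_top tsum_bound_ne_top
    (ENNReal.tsum_le_tsum fun n => mul_le_mul_right (rhoN_succ_le_natCast n X Y) _)

theorem rho_self (X : PtEMet.{u}) : rho X X = 0 := by
  simp [rho, rhoN]

theorem rho_comm (X Y : PtEMet.{u}) : rho X Y = rho Y X := by
  simp only [rho, rhoN, Metric.hausdorffEDist_comm]

theorem rho_triangle (X Y Z : PtEMet.{u}) : rho X Z ≤ rho X Y + rho Y Z := by
  unfold rho
  rw [← ENNReal.tsum_add]
  refine ENNReal.tsum_le_tsum fun n => ?_
  rw [← mul_add]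
  exact mul_le_mul_right Metric.hausdorffEDist_triangle _

theorem rho_congr {X X' Y Y' : PtEMet.{u}} (hX : X ≈ X') (hY : Y ≈ Y') : rho X Y = rho X' Y' := by
  have h : ∀ {X X' : PtEMet.{u}}, X ≈ X' → pyramid X = pyramid X' := fun h =>
    (pyramid_mono h.1).antisymm (pyramid_mono h.2)
  simp only [rho, rhoN, h hX, h hY]

theorem rho_le_of_forall_rhoN_le {X Y : PtEMet.{u}} {r : ℝ≥0∞}
    (h : ∀ n, rhoN (n + 1) X Y ≤ r) : rho X Y ≤ r := by
  calc rho X Y ≤ ∑' n : ℕ, (2⁻¹ : ℝ≥0∞) ^ (n + 1) * r :=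
        ENNReal.tsum_le_tsum fun n => mul_le_mul_right (h n) _
    _ = r := by
      rw [ENNReal.tsum_mul_right, ENNReal.tsum_geometric_add_one, ENNReal.one_sub_inv_two, inv_inv,
        ENNReal.inv_mul_cancel (by simp) (by simp), one_mul]

/-- Dominated convergence: `ρ_N ≤ N` and `∑ N 2^{-N}` is finite, so the tails are uniformly small.
-/
theorem tendsto_rho_of_tendsto_rhoN {α : Type*} {l : Filter α} {X : α → PtEMet.{u}}
    {Y : PtEMet.{u}} (h : ∀ n, Tendsto (fun a => rhoN (n + 1) (X a) Y) l (𝓝 0)) :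
    Tendsto (fun a => rho (X a) Y) l (𝓝 0) := by
  rw [ENNReal.tendsto_nhds_zero]
  intro ε hε
  have hε2 : 0 < ε / 2 := ENNReal.half_pos hε.ne'
  obtain ⟨m, hm⟩ := (ENNReal.tendsto_nhds_zero.1
    (ENNReal.tendsto_sum_nat_add _ tsum_bound_ne_top) (ε / 2) hε2).exists
  have hfin : Tendsto (fun a => ∑ n ∈ Finset.range m, (2⁻¹ : ℝ≥0∞) ^ (n + 1) * rhoN (n + 1) (X a) Y)
      l (𝓝 0) := by
    have := tendsto_finsetSum (Finset.range m) fun n _ =>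
      ENNReal.Tendsto.const_mul (a := (2⁻¹ : ℝ≥0∞) ^ (n + 1)) (h n) (Or.inr (by simp))
    simpa using this
  filter_upwards [ENNReal.tendsto_nhds_zero.1 hfin (ε / 2) hε2] with a ha
  rw [rho, ← ENNReal.summable.sum_add_tsum_nat_add' (k := m), ← ENNReal.add_halves ε]
  exact add_le_add ha ((ENNReal.tsum_le_tsum fun n =>
    mul_le_mul_right (rhoN_succ_le_natCast (n + m) (X a) Y) _).trans hm)

/-! ### Truncated finite subspaces -/

/-- The metric `min (d, D + 1)` on a subset of an extended metric space. -/
noncomputable abbrev truncMetric {E : Type*} [EMetricSpace E] (s : Set E) (D : ℕ) :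
    MetricSpace s where
  dist a b := (min (edist a b) ((D + 1 : ℕ) : ℝ≥0∞)).toReal
  dist_self a := by simp
  dist_comm a b := by simp only [edist_comm]
  dist_triangle a b c := by
    rw [← ENNReal.toReal_add (by simp) (by simp)]
    refine ENNReal.toReal_mono (by simp) ?_
    refine (min_le_min_right _ (edist_triangle a b c)).trans ?_
    rcases le_total (edist a b) ((D + 1 : ℕ) : ℝ≥0∞) with h | h <;>
    rcases le_total (edist b c) ((D + 1 : ℕ) : ℝ≥0∞) with h' | h' <;>
    simp only [min_eq_left, min_eq_right, h, h']
    · exact min_le_left _ _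
    · exact (min_le_right _ _).trans le_add_self
    · exact (min_le_right _ _).trans le_self_add
    · exact (min_le_right _ _).trans le_self_add
  eq_of_dist_eq_zero := by
    intro a b h
    rcases (ENNReal.toReal_eq_zero_iff _).1 h with h | h
    · rcases min_eq_iff.1 h with h | h
      · exact edist_eq_zero.1 h.1
      · exact absurd h.1 (by simp)
    · simp at h

/-- A finite subset of `X` together with the base point, with the metric `min (d, D + 1)`. -/
noncomputable def truncSpace (X : PtEMet.{u}) (A : Finset X.carrier) (D : ℕ) : PtCpt.{u} where
  carrier := (insert X.base (A : Set X.carrier) : Set X.carrier)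
  base := ⟨X.base, Set.mem_insert _ _⟩
  metric := truncMetric _ D
  compact := @Finite.compactSpace _ (_) (Set.Finite.to_subtype (A.finite_toSet.insert _))

/-- A point of `truncSpace X A D` given by a point of `X`. -/
def truncSpace.mk {X : PtEMet.{u}} {A : Finset X.carrier} {D : ℕ} (x : X.carrier)
    (hx : x = X.base ∨ x ∈ A) : (truncSpace X A D).carrier := ⟨x, hx⟩

/-- The inclusion of `truncSpace X A D` in `X`. -/
def truncSpace.val {X : PtEMet.{u}} {A : Finset X.carrier} {D : ℕ}
    (x : (truncSpace X A D).carrier) : X.carrier := Subtype.val x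

theorem truncSpace.edist_eq {X : PtEMet.{u}} {A : Finset X.carrier} {D : ℕ}
    (a b : (truncSpace X A D).carrier) :
    edist a b = min (edist (val a) (val b)) ((D + 1 : ℕ) : ℝ≥0∞) := by
  rw [edist_dist]
  exact ENNReal.ofReal_toReal (by simp)

theorem truncSpace_precsim (X : PtEMet.{u}) (A : Finset X.carrier) (D : ℕ) :
    Precsim (truncSpace X A D).toPtEMet X :=
  precsim_of_le truncSpace.val rfl fun x x' =>
    (truncSpace.edist_eq x x').le.trans (min_le_left _ _)

theorem truncSpace_mem_finiteSpaces (X : PtEMet.{u}) (A : Finset X.carrier) {D m : ℕ}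
    (hA : A.card ≤ m) (hD : D ≤ m) :
    PtGHSpace.mk (truncSpace X A D) ∈ finiteSpaces (m + 1) ((m + 1 : ℕ) : ℝ) := by
  refine ⟨_, ⟨?_, ?_⟩, rfl⟩
  · change ((insert X.base (A : Set X.carrier) : Set X.carrier)).encard ≤ _
    refine (Set.encard_insert_le _ _).trans ?_
    rw [Set.encard_coe_eq_coe_finsetCard]
    exact_mod_cast Nat.succ_le_succ hA
  · refine Metric.diam_le_of_forall_dist_le (by positivity) fun a _ b _ => ?_
    rw [dist_edist, truncSpace.edist_eq]
    refine (ENNReal.toReal_mono (by simp) (min_le_right _ _)).trans ?_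
    rw [ENNReal.toReal_natCast]
    exact_mod_cast Nat.succ_le_succ hD

/-- The finite parts are compact, so zero Hausdorff distance makes them equal. A test of `X ≾ Y`
involves finitely many points and finite bounds, hence takes place in a truncated finite subspace of
`X`, which lies in the pyramid of `Y`. -/
theorem precsim_of_rho_eq_zero {X Y : PtEMet.{u}} (h : rho X Y = 0) : Precsim X Y := by
  have hpyr : ∀ n : ℕ, pyramid X ∩ finiteSpaces (n + 1) ((n + 1 : ℕ) : ℝ) =
      pyramid Y ∩ finiteSpaces (n + 1) ((n + 1 : ℕ) : ℝ) := by
    intro n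
    have hn := ENNReal.tsum_eq_zero.1 h n
    replace hn : rhoN (n + 1) X Y = 0 := (mul_eq_zero.1 hn).resolve_left (by simp)
    rw [rhoN, Metric.hausdorffEDist_zero_iff_closure_eq_closure] at hn
    have hc : ∀ X : PtEMet.{u}, IsClosed (pyramid X ∩ finiteSpaces (n + 1) ((n + 1 : ℕ) : ℝ)) :=
      fun X => by
        rw [← image_tuplesBelow]
        exact ((isCompact_tuplesBelow n X).image (lipschitzWith_tupleClass n).continuous).isClosed
    rwa [(hc X).closure_eq, (hc Y).closure_eq] at hn
  rw [precsim_iff]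
  intro N x hx c hc
  -- Truncating at `D + 1` then leaves all the strict bounds intact, including those at infinite
  -- distances.
  obtain ⟨D, hD⟩ : ∃ D : ℕ, ∀ i j, c i j < D := by
    have : ∀ᶠ D : ℕ in atTop, ∀ i j, c i j < D := by
      refine eventually_all.2 fun i => eventually_all.2 fun j => ?_
      have hlt : c i j < ∞ := by
        rcases hc i j with h | h
        · simp [h]
        · exact h.trans_le le_top
      exact ENNReal.tendsto_nat_nhds_top.eventually_const_lt hlt
    exact this.exists
  let A := (Set.finite_range x).toFinset
  have hmem : PtGHSpace.mk (truncSpace X A D) ∈ pyramid Y := by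
    have := hpyr (max A.card D)
    exact (this.subset ⟨mk_mem_pyramid.2 (truncSpace_precsim X A D),
      truncSpace_mem_finiteSpaces X A (le_max_left _ _) (le_max_right _ _)⟩).1
  obtain ⟨y, hy0, hy⟩ := (precsim_iff _ _).1 (mk_mem_pyramid.1 hmem) N
    (fun i => truncSpace.mk (x i) (Or.inr (by simp [A]))) (Subtype.ext hx) c fun i j => by
      refine (hc i j).imp id fun h => ?_
      change _ < edist (α := (truncSpace X A D).carrier) _ _
      rw [truncSpace.edist_eq]
      refine lt_min h ((hD i j).trans_le ?_)
      exact_mod_cast Nat.le_succ D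
  exact ⟨y, hy0, hy⟩

/-- The extended metric `ρ` on `𝓜₀/∼`. -/
noncomputable abbrev MSpace.emetricSpace : EMetricSpace MSpace.{u} where
  edist := Quotient.lift₂ rho fun _ _ _ _ h h' => rho_congr h h'
  edist_self := by
    rintro ⟨X⟩
    exact rho_self X
  edist_comm := by
    rintro ⟨X⟩ ⟨Y⟩
    exact rho_comm X Y
  edist_triangle := by
    rintro ⟨X⟩ ⟨Y⟩ ⟨Z⟩
    exact rho_triangle X Y Z
  eq_of_edist_eq_zero := by
    rintro ⟨X⟩ ⟨Y⟩ h
    exact Quotient.sound ⟨precsim_of_rho_eq_zero h, precsim_of_rho_eq_zero ((rho_comm Y X).trans h)⟩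

/-- The metric `ρ` on `𝓜₀/∼`. -/
noncomputable abbrev MSpace.metricSpace : MetricSpace MSpace.{u} :=
  let _ := MSpace.emetricSpace.{u}
  EMetricSpace.toMetricSpace (by
    rintro ⟨X⟩ ⟨Y⟩
    exact rho_ne_top X Y)

section MSpaceMetric

attribute [local instance] MSpace.metricSpace

theorem MSpace.edist_mk (X Y : PtEMet.{u}) : edist (MSpace.mk X) (MSpace.mk Y) = rho X Y := rfl

theorem MSpace.tendsto_mk {α : Type*} {l : Filter α} {X : α → PtEMet.{u}} {Y : PtEMet.{u}} :
    Tendsto (fun a => MSpace.mk (X a)) l (𝓝 (MSpace.mk Y)) ↔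
      Tendsto (fun a => rho (X a) Y) l (𝓝 0) :=
  tendsto_iff_edist_tendsto_0

/-! ### Convergence of `ρ_N` -/

/-- The second hypothesis concerns one tuple at a time; compactness of `tuplesBelow n Y` makes it
uniform. -/
theorem tendsto_rhoN {α : Type*} {l : Filter α} {X : α → PtEMet.{u}} {Y : PtEMet.{u}} {n : ℕ}
    (h₁ : ∀ ε : ℝ≥0∞, 0 < ε →
      ∀ᶠ a in l, ∀ q ∈ tuplesBelow n (X a), ∃ q' ∈ tuplesBelow n Y, edist q q' ≤ ε)
    (h₂ : ∀ q ∈ tuplesBelow n Y, ∀ t : ℝ≥0∞, t < 1 → ∀ᶠ a in l,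
      ∃ x : Fin (n + 1) → (X a).carrier, x 0 = (X a).base ∧
        ∀ i j, t * edist (q i) (q j) ≤ edist (x i) (x j)) :
    Tendsto (fun a => rhoN (n + 1) (X a) Y) l (𝓝 0) := by
  rw [ENNReal.tendsto_nhds_zero]
  intro ε hε
  have key : ∀ᶠ a in l, ∀ q ∈ tuplesBelow n Y, ∃ q' ∈ tuplesBelow n (X a), edist q q' ≤ ε := by
    refine (isCompact_tuplesBelow n Y).induction_on
      (p := fun s => ∀ᶠ a in l, ∀ q ∈ s, ∃ q' ∈ tuplesBelow n (X a), edist q q' ≤ ε) ?_ ?_ ?_ ?_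
    · simp
    · exact fun s t hst ht => ht.mono fun a ha q hq => ha q (hst hq)
    · intro s t hs ht
      filter_upwards [hs, ht] with a has hat q hq
      exact hq.elim (has q) (hat q)
    · intro q hq
      have hε2 : 0 < ε / 2 := ENNReal.half_pos hε.ne'
      -- The single tuple `t • q` serves every `p` within `ε / 2` of `q`.
      obtain ⟨t, ht0, ht1, ht⟩ := exists_smul_near q hε2
      refine ⟨_, mem_nhdsWithin_of_mem_nhds (Metric.eball_mem_nhds q hε2), ?_⟩
      filter_upwards [h₂ q hq (ENNReal.ofReal t) (by simpa using ht1)] with a ⟨x, hx0, hx⟩ p hp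
      refine ⟨t • q, smul_mem_tuplesBelow hq.1 ht0 ht1.le x hx0 hx, ?_⟩
      calc edist p (t • q) ≤ edist p q + edist q (t • q) := edist_triangle _ _ _
        _ ≤ ε / 2 + ε / 2 := add_le_add (Metric.mem_eball.1 hp).le ht
        _ = ε := ENNReal.add_halves ε
  filter_upwards [h₁ ε hε, key] with a ha ha' using rhoN_succ_le ha ha'

/-! ### Density of compact spaces -/

theorem tendsto_rho_truncSpace (X : PtEMet.{u}) :
    Tendsto (fun a : Finset X.carrier × ℕ => rho (truncSpace X a.1 a.2).toPtEMet X) atTop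
      (𝓝 0) := by
  classical
  refine tendsto_rho_of_tendsto_rhoN fun n => tendsto_rhoN ?_ ?_
  · intro ε _
    refine Eventually.of_forall fun a q hq => ?_
    exact ⟨q, ⟨hq.1, Precsim.trans hq.2 (truncSpace_precsim X a.1 a.2)⟩, by simp⟩
  · intro q hq t ht
    obtain ⟨x, hx0, hx⟩ := rangeSpace_precsim_iff.1 hq.2 t ht
    -- From `n` on, truncation happens at `n + 1` or above, which bounds all distances between
    -- entries of a cube tuple.
    filter_upwards [eventually_ge_atTop (Finset.univ.image x, n)] with a ha
    refine ⟨fun i => truncSpace.mk (A := a.1) (D := a.2) (x i) (Or.inr (ha.1 (Finset.mem_image_of_mem x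
      (Finset.mem_univ i)))), Subtype.ext hx0, fun i j => ?_⟩
    change _ ≤ edist (α := (truncSpace X a.1 a.2).carrier) _ _
    rw [truncSpace.edist_eq]
    refine le_min (hx i j) ((mul_le_of_le_one_left zero_le ht.le).trans ?_)
    rw [edist_dist, ← ENNReal.ofReal_natCast]
    refine ENNReal.ofReal_le_ofReal ((dist_le_of_mem_cube hq.1 hq.1 i j).trans ?_)
    exact_mod_cast Nat.succ_le_succ ha.2

theorem denseRange_toMSpace : DenseRange PtGHSpace.toMSpace.{u} := by
  rintro ⟨X⟩
  classical
  exact mem_closure_of_tendsto (MSpace.tendsto_mk.2 (tendsto_rho_truncSpace X))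
    (Eventually.of_forall fun a => ⟨PtGHSpace.mk (truncSpace X a.1 a.2), rfl⟩)

/-! ### The projection is Lipschitz -/

/-- The assignment `φ (x i) ↦ q i` is 1-Lipschitz on a finite subset of `Z`. A 1-Lipschitz extension
to `Z`, evaluated at `ψ (y i)`, is dominated by `Y` and moves each entry by at most `ε`. -/
theorem exists_tuple_near {X Y : PtCpt.{u}} {Z : Type u} [MetricSpace Z] {φ : X.carrier → Z}
    {ψ : Y.carrier → Z} (hφ : Isometry φ) (hψ : Isometry ψ) {ε : ℝ≥0∞} {n : ℕ} {q : Tuples.{u} n}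
    (hq : q ∈ cube n) (x : Fin (n + 1) → X.carrier) (y : Fin (n + 1) → Y.carrier)
    (hy₀ : y 0 = Y.base) (hx : ∀ i j, edist (q i) (q j) ≤ edist (x i) (x j))
    (hxy : ∀ i, edist (φ (x i)) (ψ (y i)) ≤ ε) :
    ∃ q' ∈ tuplesBelow n Y.toPtEMet, edist q q' ≤ ε := by
  have hfac : q.FactorsThrough (φ ∘ x) := fun i j hij => by
    have := hx i j
    rw [hφ.injective hij, edist_self] at this
    exact edist_eq_zero.1 (le_antisymm this zero_le)
  have hlip : LipschitzOnWith 1 (Function.extend (φ ∘ x) q 0) (Set.range (φ ∘ x)) := by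
    rintro _ ⟨i, rfl⟩ _ ⟨j, rfl⟩
    rw [hfac.extend_apply, hfac.extend_apply]
    simpa [hφ.edist_eq] using hx i j
  obtain ⟨g, hg, hgq⟩ := hlip.extend_pi
  -- Clamping puts the new tuple in the cube, keeps the Lipschitz constant and does not change the
  -- values `q i`.
  let h : Z → ULift.{u} (Fin (n + 1)) → ℝ := fun z k => max 0 (min (g z k) ((n + 1 : ℕ) : ℝ))
  have hh : LipschitzWith 1 h := fun z w => by
    refine edist_pi_le_iff.2 fun k => ?_
    exact (((((LipschitzWith.eval k).comp hg).min_const _).const_max 0).edist_le_mul z w).trans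
      (by simp)
  have hhq : ∀ i, h (φ (x i)) = q i := fun i => by
    have h1 : g (φ (x i)) = q i := by
      exact (hgq ⟨i, rfl⟩).symm.trans (hfac.extend_apply 0 i)
    funext k
    obtain ⟨h2, h3⟩ := mem_cube.1 hq i k
    simp only [h, h1, min_eq_left h3, max_eq_right h2]
  refine ⟨fun i => h (ψ (y i)), ⟨mem_cube.2 fun i k => ⟨le_max_left _ _,
    max_le (by positivity) (min_le_right _ _)⟩, rangeSpace_precsim_of_le y hy₀ fun i j => ?_⟩, ?_⟩
  · refine (hh.edist_le_mul _ _).trans ?_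
    rw [hψ.edist_eq, ENNReal.coe_one, one_mul]
    exact le_rfl
  · refine edist_pi_le_iff.2 fun i => ?_
    rw [← hhq i]
    refine (hh.edist_le_mul _ _).trans ?_
    simpa using hxy i

theorem exists_tuplesBelow_near {X Y : PtCpt.{u}} {ε : ℝ} (h : ptGHDist X Y < ε) {δ : ℝ≥0∞}
    (hδ : 0 < δ) {n : ℕ} {q : Tuples.{u} n} (hq : q ∈ tuplesBelow n X.toPtEMet) :
    ∃ q' ∈ tuplesBelow n Y.toPtEMet, edist q q' ≤ δ + ENNReal.ofReal ε := by
  obtain ⟨r, hr, hrε⟩ := (csInf_lt_iff (couplingValues_bddBelow X Y)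
    (couplingValues_nonempty X Y)).1 h
  obtain ⟨Z, _, _, φ, ψ, hφ, hψ, rfl⟩ := hr
  rw [max_lt_iff] at hrε
  have : Nonempty X.carrier := ⟨X.base⟩
  have : Nonempty Y.carrier := ⟨Y.base⟩
  have hnear : ∀ a, ∃ b, dist (φ a) (ψ b) < ε := fun a => by
    obtain ⟨_, ⟨b, rfl⟩, hb⟩ := Metric.exists_dist_lt_of_hausdorffDist_lt (Set.mem_range_self a)
      hrε.1 (Metric.hausdorffEDist_ne_top_of_nonempty_of_bounded (Set.range_nonempty _)
        (Set.range_nonempty _) (Bornology.IsBounded.all _) (Bornology.IsBounded.all _))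
    exact ⟨b, hb⟩
  choose b hb using hnear
  obtain ⟨t, ht0, ht1, ht⟩ := exists_smul_near q hδ
  obtain ⟨x, hx0, hx⟩ := rangeSpace_precsim_iff.1 hq.2 (ENNReal.ofReal t) (by simpa using ht1)
  -- The base point of `Y` is forced at index `0`; the coupling also bounds the distance of the base
  -- points. The term `δ` pays for the shrinking to `t • q`.
  obtain ⟨q', hq', hqq'⟩ := exists_tuple_near hφ hψ (ε := ENNReal.ofReal ε)
    (smul_mem_cube hq.1 ht0 ht1.le) x (Function.update (fun i => b (x i)) 0 Y.base) (by simp)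
    (fun i j => by
      rw [Pi.smul_apply, Pi.smul_apply, edist_smul₀, ENNReal.smul_def, smul_eq_mul]
      change ‖t‖ₑ * _ ≤ _
      rw [Real.enorm_eq_ofReal ht0]
      exact hx i j)
    (fun i => by
      rw [edist_dist]
      refine ENNReal.ofReal_le_ofReal ?_
      by_cases hi : i = 0
      · subst hi
        rw [Function.update_self, hx0]
        exact hrε.2.le
      · rw [Function.update_of_ne hi]
        exact (hb _).le)
  exact ⟨q', hq', (edist_triangle _ _ _).trans (add_le_add ht hqq')⟩

theorem lipschitzWith_toMSpace : LipschitzWith 3 PtGHSpace.toMSpace.{u} := by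
  rintro ⟨X⟩ ⟨Y⟩
  change edist (PtGHSpace.mk X).toMSpace (PtGHSpace.mk Y).toMSpace ≤
    3 * edist (PtGHSpace.mk X) (PtGHSpace.mk Y)
  by_cases hXY : PtGHSpace.mk X = PtGHSpace.mk Y
  · simp [hXY]
  have hd : 0 < ptGHDist X Y := dist_pos.2 hXY
  rw [edist_dist (PtGHSpace.mk X), PtGHSpace.dist_mk, PtGHSpace.toMSpace_mk, PtGHSpace.toMSpace_mk,
    MSpace.edist_mk]
  have hd' : ptGHDist Y X = ptGHDist X Y := dist_comm (PtGHSpace.mk Y) (PtGHSpace.mk X)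
  -- The constant 3 comes from `δ = d` and `ε = 2 * d`: it suffices that `δ` is positive and `ε`
  -- exceeds the distance `d`.
  have h3 : ENNReal.ofReal (ptGHDist X Y) + ENNReal.ofReal (2 * ptGHDist X Y) =
      3 * ENNReal.ofReal (ptGHDist X Y) := by
    rw [ENNReal.ofReal_mul (by norm_num), ENNReal.ofReal_ofNat]
    ring
  rw [← h3]
  refine rho_le_of_forall_rhoN_le fun n => rhoN_succ_le ?_ ?_
  · exact fun q hq => exists_tuplesBelow_near (by linarith) (by simpa using hd) hq
  · exact fun q hq => exists_tuplesBelow_near (by linarith) (by simpa using hd) hq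

/-! ### Ultralimits -/

/-- The point of the ultralimit represented by a sequence. -/
noncomputable def ultralimit.mk (U : Ultrafilter ℕ) {X : ℕ → PtEMet.{u}} (x : ∀ n, (X n).carrier) :
    (ultralimit U X).carrier := SeparationQuotient.mk (X := UltraProd U X) x

theorem ultralimit.surjective_mk (U : Ultrafilter ℕ) (X : ℕ → PtEMet.{u}) :
    Function.Surjective (ultralimit.mk U (X := X)) := fun y =>
  SeparationQuotient.surjective_mk (X := UltraProd U X) y

theorem ultralimit.mk_base (U : Ultrafilter ℕ) (X : ℕ → PtEMet.{u}) :
    ultralimit.mk U (fun n => (X n).base) = (ultralimit U X).base := rfl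

theorem ultralimit.tendsto_edist (U : Ultrafilter ℕ) {X : ℕ → PtEMet.{u}}
    (x y : ∀ n, (X n).carrier) :
    Tendsto (fun n => edist (x n) (y n)) U (𝓝 (edist (mk U x) (mk U y))) :=
  tendsto_ultraEDist U X x y

theorem ultralimit.exists_rep (U : Ultrafilter ℕ) {X : ℕ → PtEMet.{u}} {ι : Type*}
    (x : ι → (ultralimit U X).carrier) (i₀ : ι) (hx : x i₀ = (ultralimit U X).base) :
    ∃ a : ι → ∀ n, (X n).carrier, a i₀ = (fun n => (X n).base) ∧ ∀ i, mk U (a i) = x i := by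
  classical
  choose r hr using surjective_mk U X
  refine ⟨fun i => if i = i₀ then fun n => (X n).base else r (x i), by simp, fun i => ?_⟩
  by_cases hi : i = i₀
  · simp [hi, hx, mk_base]
  · simp [hi, hr]

/-- Limits along `U` of tuples dominated by `X k` are dominated by the ultralimit, since
near-realising points assemble into points of it. Conversely, representatives of finitely many
points of the ultralimit nearly realise their distances in `U`-almost every `X k`. -/
theorem tendsto_rho_ultralimit (U : Ultrafilter ℕ) (X : ℕ → PtEMet.{u}) :
    Tendsto (fun n => rho (X n) (ultralimit U X)) U (𝓝 0) := by
  refine tendsto_rho_of_tendsto_rhoN fun n => tendsto_rhoN ?_ ?_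
  · intro ε hε
    let good : ℕ → Tuples.{u} n → Prop := fun k q =>
      ∃ q' ∈ tuplesBelow n (ultralimit U X), edist q q' ≤ ε
    -- `p k` is a worst case: a bad tuple if there is one. Uniformity over `q` thus reduces to the
    -- single sequence `p`.
    have hp : ∀ k, ∃ p ∈ tuplesBelow n (X k), good k p → ∀ q ∈ tuplesBelow n (X k), good k q := by
      intro k
      by_cases h : ∀ q ∈ tuplesBelow n (X k), good k q
      · exact ⟨0, zero_mem_tuplesBelow n _, fun _ => h⟩
      · push Not at h
        obtain ⟨q, hq, hgq⟩ := h
        exact ⟨q, hq, fun h => absurd h hgq⟩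
    choose p hpmem hp using hp
    obtain ⟨q, hq, hlim⟩ := (isCompact_cube n).ultrafilter_le_nhds (U.map p)
      (tendsto_principal.2 (Eventually.of_forall fun k => (hpmem k).1))
    replace hlim : Tendsto p U (𝓝 q) := hlim
    have hqL : q ∈ tuplesBelow n (ultralimit U X) := by
      refine ⟨hq, rangeSpace_precsim_iff.2 fun t ht => ?_⟩
      have hev := eventually_exists_of_tendsto hlim (X := X)
        (Eventually.of_forall fun k => (hpmem k).2) ht
      have hx : ∀ k, ∃ x : Fin (n + 1) → (X k).carrier, x 0 = (X k).base ∧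
          ((∃ x : Fin (n + 1) → (X k).carrier, x 0 = (X k).base ∧
            ∀ i j, t * edist (q i) (q j) ≤ edist (x i) (x j)) →
            ∀ i j, t * edist (q i) (q j) ≤ edist (x i) (x j)) := by
        intro k
        by_cases h : ∃ x : Fin (n + 1) → (X k).carrier, x 0 = (X k).base ∧
            ∀ i j, t * edist (q i) (q j) ≤ edist (x i) (x j)
        · exact ⟨h.choose, h.choose_spec.1, fun _ => h.choose_spec.2⟩
        · exact ⟨fun _ => (X k).base, rfl, fun h' => absurd h' h⟩
      choose x hx0 hx using hx
      refine ⟨fun i => ultralimit.mk U fun k => x k i, ?_, fun i j => ?_⟩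
      · simp only [hx0, ultralimit.mk_base]
      · exact ge_of_tendsto (ultralimit.tendsto_edist U _ _) (hev.mono fun k hk => hx k hk i j)
    have hclose : ∀ᶠ k in U, edist (p k) q ≤ ε :=
      ((tendsto_iff_edist_tendsto_0.1 hlim).eventually_lt_const hε).mono fun _ h => h.le
    exact hclose.mono fun k hk => hp k ⟨q, hqL, hk⟩
  · intro q hq t ht
    obtain ⟨s, hts, hs⟩ := exists_between ht
    obtain ⟨x, hx0, hx⟩ := rangeSpace_precsim_iff.1 hq.2 s hs
    obtain ⟨a, ha0, ha⟩ := ultralimit.exists_rep U x 0 hx0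
    have key : ∀ᶠ k in U, ∀ i j, t * edist (q i) (q j) ≤ edist (a i k) (a j k) := by
      refine eventually_all.2 fun i => eventually_all.2 fun j => ?_
      by_cases hij : q i = q j
      · simp [hij]
      · have h0 : edist (q i) (q j) ≠ 0 := by simpa using hij
        have hlt := (ENNReal.mul_lt_mul_left h0 (edist_ne_top _ _) hts).trans_le (hx i j)
        have hlim := ultralimit.tendsto_edist U (a i) (a j)
        rw [ha, ha] at hlim
        exact (hlim.eventually_const_lt hlt).mono fun _ h => h.le
    exact key.mono fun k hk => ⟨fun i => a i k, by simp [ha0], hk⟩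

theorem MSpace.compactSpace : CompactSpace MSpace.{u} := by
  refine ⟨IsSeqCompact.isCompact fun u _ => ?_⟩
  choose X hX using fun n => Quotient.exists_rep (u n)
  refine ⟨MSpace.mk (ultralimit (hyperfilter ℕ) X), Set.mem_univ _, ?_⟩
  -- The limit along a non-principal ultrafilter is a cluster point of the sequence, hence a
  -- subsequential limit in a metric space.
  refine MapClusterPt.tendsto_subseq
    (mapClusterPt_iff_ultrafilter.2 ⟨hyperfilter ℕ, Nat.hyperfilter_le_atTop, ?_⟩)
  have := MSpace.tendsto_mk.2 (tendsto_rho_ultralimit (hyperfilter ℕ) X)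
  exact this.congr fun n => hX n

theorem ultralimit_equiv_of_tendsto {X : ℕ → PtEMet.{u}} {Y : PtEMet.{u}} {U : Ultrafilter ℕ}
    (h : Tendsto (fun n => rho (X n) Y) U (𝓝 0)) : ultralimit U X ≈ Y :=
  have : MSpace.mk (ultralimit U X) = MSpace.mk Y := tendsto_nhds_unique
    (MSpace.tendsto_mk.2 (tendsto_rho_ultralimit U X)) (MSpace.tendsto_mk.2 h)
  Quotient.exact this

/-! ### Noncontracting maps -/

theorem exists_seq_lt_tendsto (d : ℝ≥0∞) :
    ∃ s : ℕ → ℝ≥0∞, (∀ k, s k = 0 ∨ s k < d) ∧ Tendsto s atTop (𝓝 d) := by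
  rcases eq_or_ne d 0 with rfl | hd
  · exact ⟨fun _ => 0, fun _ => Or.inl rfl, tendsto_const_nhds⟩
  · obtain ⟨s, -, h2, h3⟩ := exists_seq_strictMono_tendsto' (pos_iff_ne_zero.2 hd)
    exact ⟨s, fun k => Or.inr (h2 k).2, h3⟩

theorem Precsim.exists_map {X Y : PtEMet.{u}} (h : Precsim X Y) (A : Finset X.carrier)
    (c : X.carrier → X.carrier → ℝ≥0∞) (hc : ∀ a b, c a b = 0 ∨ c a b < edist a b) :
    ∃ f : X.carrier → Y.carrier, f X.base = Y.base ∧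
      ∀ a ∈ A, ∀ b ∈ A, c a b ≤ edist (f a) (f b) := by
  classical
  obtain ⟨y, hy0, hy⟩ := h.exists_finite (fun a : (insert X.base A : Finset X.carrier) => a.1)
    ⟨_, Finset.mem_insert_self _ _⟩ rfl (fun a b => c a.1 b.1) fun a b => hc _ _
  refine ⟨fun a => if ha : a ∈ insert X.base A then y ⟨a, ha⟩ else Y.base, ?_, ?_⟩
  · simpa using hy0
  · intro a ha b hb
    simpa [ha, hb] using hy ⟨a, Finset.mem_insert_of_mem ha⟩ ⟨b, Finset.mem_insert_of_mem hb⟩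

/-- For each finite set and precision there is an almost noncontracting map. The maps `Z → X` form a
compact space by Tychonoff, and an ultrafilter limit over finite sets and precisions is
noncontracting. -/
theorem Precsim.exists_noncontracting {Z : PtEMet.{u}} {X : PtCpt.{u}}
    (h : Precsim Z X.toPtEMet) : ∃ f : Z.carrier → X.carrier, f Z.base = X.base ∧
      ∀ a b, edist a b ≤ edist (f a) (f b) := by
  classical
  choose s hs hs' using exists_seq_lt_tendsto
  choose f hf0 hf using fun p : Finset Z.carrier × ℕ =>
    h.exists_map p.1 (fun a b => s (edist a b) p.2) fun a b => hs _ _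
  change ∀ p : Finset Z.carrier × ℕ, Z.carrier → X.carrier at f
  let U : Ultrafilter (Finset Z.carrier × ℕ) := Ultrafilter.of atTop
  have hU : (U : Filter (Finset Z.carrier × ℕ)) ≤ atTop := Ultrafilter.of_le atTop
  have hF : Tendsto f U (𝓝 (U.map f).lim) := (U.map f).le_nhds_lim
  set F := (U.map f).lim
  rw [tendsto_pi_nhds] at hF
  refine ⟨F, tendsto_nhds_unique (hF Z.base) (tendsto_const_nhds.congr fun p => (hf0 p).symm), fun a b => ?_⟩
  have hsnd : Tendsto Prod.snd (U : Filter (Finset Z.carrier × ℕ)) atTop :=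
    tendsto_snd.mono_left (hU.trans prod_atTop_atTop_eq.ge)
  refine le_of_tendsto_of_tendsto ((hs' (edist a b)).comp hsnd) ((hF a).edist (hF b))
    (hU ?_)
  filter_upwards [eventually_ge_atTop ({a, b}, 0)] with p hp
  exact hf p a (hp.1 (by simp)) b (hp.1 (by simp))

/-- A noncontracting self-map of a compact metric space is a surjective isometry. -/
theorem isometry_surjective_of_noncontracting {X : Type*} [MetricSpace X] [CompactSpace X]
    {f : X → X} (hf : ∀ a b, edist a b ≤ edist (f a) (f b)) :
    Isometry f ∧ Function.Surjective f := by
  have hiter : ∀ n a b, edist a b ≤ edist (f^[n] a) (f^[n] b) := by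
    intro n
    induction n with
    | zero => simp
    | succ n ih =>
      intro a b
      rw [Function.iterate_succ_apply', Function.iterate_succ_apply']
      exact (ih a b).trans (hf _ _)
  -- Simultaneous recurrence: two close terms of the orbit of `(a, b)` bring `(a, b)` itself back,
  -- because the iterates do not contract.
  have hrec : ∀ a b, ∀ ε : ℝ≥0∞, 0 < ε →
      ∃ k, edist (f^[k + 1] a) a < ε ∧ edist (f^[k + 1] b) b < ε := by
    intro a b ε hε
    obtain ⟨c, φ, hφ, hc⟩ := CompactSpace.tendsto_subseq fun n => (f^[n] a, f^[n] b)
    obtain ⟨N, hN⟩ := EMetric.cauchySeq_iff'.1 hc.cauchySeq ε hε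
    have hlt : φ N < φ (N + 1) := hφ (Nat.lt_succ_self N)
    obtain ⟨k, hk⟩ := Nat.exists_eq_add_of_lt hlt
    have := hN (N + 1) (Nat.le_succ N)
    simp only [Function.comp_apply, Prod.edist_eq, max_lt_iff, hk, add_assoc,
      Function.iterate_add_apply f (φ N)] at this
    exact ⟨k, (hiter _ _ _).trans_lt this.1, (hiter _ _ _).trans_lt this.2⟩
  have hiso : Isometry f := by
    intro a b
    refine le_antisymm (le_of_forall_pos_le_add fun ε hε => ?_) (hf a b)
    obtain ⟨k, hka, hkb⟩ := hrec a b (ε / 2) (ENNReal.half_pos hε.ne')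
    calc edist (f a) (f b) ≤ edist (f^[k] (f a)) (f^[k] (f b)) := hiter _ _ _
      _ ≤ edist (f^[k + 1] a) a + edist a b + edist b (f^[k + 1] b) := edist_triangle4 _ _ _ _
      _ ≤ ε / 2 + edist a b + ε / 2 := by
        rw [edist_comm b]
        gcongr
      _ = edist a b + (ε / 2 + ε / 2) := by ring
      _ = edist a b + ε := by rw [ENNReal.add_halves]
  refine ⟨hiso, fun a => ?_⟩
  have : a ∈ closure (Set.range f) := by
    rw [EMetric.mem_closure_iff]
    intro ε hε
    obtain ⟨k, hk, -⟩ := hrec a a ε hε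
    refine ⟨f^[k + 1] a, ⟨f^[k] a, (Function.iterate_succ_apply' f k a).symm⟩, ?_⟩
    rwa [edist_comm]
  rwa [(isCompact_range hiso.continuous).isClosed.closure_eq] at this

/-- With noncontracting `f` and `g` in both directions, rigidity makes `g ∘ f` isometric, so `f`
cannot expand, and `f ∘ g` surjective, so `f` is onto. -/
theorem PtCpt.equiv_of_precsim {X Y : PtCpt.{u}} (h : Precsim X.toPtEMet Y.toPtEMet)
    (h' : Precsim Y.toPtEMet X.toPtEMet) : X ≈ Y := by
  obtain ⟨f, hf0, hf⟩ := h.exists_noncontracting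
  obtain ⟨g, -, hg⟩ := h'.exists_noncontracting
  replace hf : ∀ a b : X.carrier, edist a b ≤ edist (f a) (f b) := hf
  replace hg : ∀ a b : Y.carrier, edist a b ≤ edist (g a) (g b) := hg
  obtain ⟨h1, -⟩ := isometry_surjective_of_noncontracting (f := g ∘ f)
    fun a b => (hf a b).trans (hg _ _)
  obtain ⟨-, h2⟩ := isometry_surjective_of_noncontracting (f := f ∘ g)
    fun a b => (hg a b).trans (hf _ _)
  have hiso : Isometry f := fun a b => le_antisymm ((hg _ _).trans_eq (h1 a b)) (hf a b)
  exact ⟨IsometryEquiv.mk (Equiv.ofBijective f ⟨hiso.injective, h2.of_comp⟩) hiso, hf0⟩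

/-- Finite nets of the range pull back along a section, which does not increase distances. -/
theorem totallyBounded_of_noncontracting {E F : Type*} [PseudoEMetricSpace E] [MetricSpace F]
    [CompactSpace F] {f : E → F} (hf : ∀ a b, edist a b ≤ edist (f a) (f b)) :
    TotallyBounded (Set.univ : Set E) := by
  have hr : TotallyBounded (Set.univ : Set (Set.range f)) := by
    rw [← totallyBounded_image_iff isUniformEmbedding_subtype_val.isUniformInducing]
    exact isCompact_univ.totallyBounded.subset (Set.subset_univ _)
  choose g hg using fun y : Set.range f => y.2
  rw [EMetric.totallyBounded_iff'] at hr ⊢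
  intro ε hε
  obtain ⟨t, -, ht, hcov⟩ := hr ε hε
  refine ⟨g '' t, Set.subset_univ _, ht.image g, fun a _ => ?_⟩
  have := hcov (Set.mem_univ ⟨f a, a, rfl⟩)
  simp only [Set.mem_iUnion, exists_prop] at this
  obtain ⟨y, hy, hay⟩ := this
  refine Set.mem_biUnion (Set.mem_image_of_mem g hy) ?_
  have h1 := hf a (g y)
  rw [hg] at h1
  exact Metric.mem_eball.2 (h1.trans_lt hay)

/-- A pointed extended metric space equivalent to a compact one embeds densely in it. -/
theorem exists_isometry_denseRange {Z : PtEMet.{u}} {X : PtCpt.{u}} (h : Z ≈ X.toPtEMet) :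
    ∃ j : Z.carrier → X.carrier, Isometry j ∧ DenseRange j ∧ j Z.base = X.base := by
  obtain ⟨f, -, hf⟩ := Precsim.exists_noncontracting h.1
  let _ : MetricSpace Z.carrier :=
    EMetricSpace.toMetricSpace fun a b => ne_top_of_le_ne_top (edist_ne_top _ _) (hf a b)
  have hdense : DenseRange ((↑) : Z.carrier → UniformSpace.Completion Z.carrier) :=
    UniformSpace.Completion.denseRange_coe
  have hiso : Isometry ((↑) : Z.carrier → UniformSpace.Completion Z.carrier) :=
    UniformSpace.Completion.coe_isometry
  have hcpt : CompactSpace (UniformSpace.Completion Z.carrier) := by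
    refine ⟨isCompact_iff_totallyBounded_isComplete.2 ⟨?_, isComplete_univ⟩⟩
    rw [← hdense.closure_range, ← Set.image_univ]
    exact ((totallyBounded_of_noncontracting hf).image
      (UniformSpace.Completion.uniformContinuous_coe _)).closure
  let C : PtCpt.{u} := { carrier := UniformSpace.Completion Z.carrier, base := (Z.base : _) }
  have hZC : Precsim Z C.toPtEMet := Precsim.of_isometry _ hiso rfl
  -- Each point of the completion is rounded to a nearby point of `Z`, the base point to itself. The
  -- completion is thus a compact space equivalent to `X`, hence isometric to it.
  have hCZ : Precsim C.toPtEMet Z := by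
    refine precsim_of_approx fun ε hε => ?_
    have hε2 : 0 < ε / 2 := ENNReal.half_pos hε.ne'
    have hr : ∀ c : UniformSpace.Completion Z.carrier, ∃ z : Z.carrier,
        edist c (z : UniformSpace.Completion Z.carrier) ≤ ε / 2 ∧
          (c = (Z.base : UniformSpace.Completion Z.carrier) → z = Z.base) := by
      intro c
      by_cases hc : c = (Z.base : UniformSpace.Completion Z.carrier)
      · subst hc
        exact ⟨Z.base, (edist_self _).trans_le zero_le, fun _ => rfl⟩
      · obtain ⟨_, ⟨z, rfl⟩, hz⟩ := EMetric.mem_closure_iff.1 (hdense c) _ hε2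
        exact ⟨z, hz.le, fun h => absurd h hc⟩
    choose r hr hr0 using hr
    have key : ∀ c c' : UniformSpace.Completion Z.carrier,
        edist c c' ≤ edist (r c) (r c') + ε := by
      intro c c'
      calc edist c c' ≤ edist c (r c : UniformSpace.Completion Z.carrier) +
            edist (r c : UniformSpace.Completion Z.carrier) (r c') +
            edist (r c' : UniformSpace.Completion Z.carrier) c' := edist_triangle4 _ _ _ _
        _ ≤ ε / 2 + edist (r c) (r c') + ε / 2 := by
          rw [hiso.edist_eq, edist_comm _ c']
          exact add_le_add (add_le_add (hr c) le_rfl) (hr c')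
        _ = edist (r c) (r c') + (ε / 2 + ε / 2) := by ring
        _ = edist (r c) (r c') + ε := by rw [ENNReal.add_halves]
    exact ⟨r, hr0 _ rfl, key⟩
  obtain ⟨e, he⟩ := PtCpt.equiv_of_precsim (hCZ.trans h.1) (Precsim.trans h.2 hZC)
  exact ⟨fun z => e (z : UniformSpace.Completion Z.carrier), e.isometry.comp hiso,
    e.surjective.denseRange.comp hdense e.continuous, he⟩

/-! ### The projection is an embedding -/

/-- The ultralimit `L` is dense in `Y`, so `Y` has a finite `ε`-net in `L`. Representatives of the
net have almost the same mutual distances in `X n` and form a net there. -/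
theorem eventually_ptGHDist_le {X : ℕ → PtCpt.{u}} {Y : PtCpt.{u}} {U : Ultrafilter ℕ}
    (h : ultralimit U (fun n => (X n).toPtEMet) ≈ Y.toPtEMet) {ε : ℝ} (hε : 0 < ε) :
    ∀ᶠ n in U, ptGHDist (X n) Y ≤ 2 * ε := by
  classical
  set L := ultralimit U (fun n => (X n).toPtEMet)
  obtain ⟨j, hj, hjd, hj0⟩ := exists_isometry_denseRange h
  obtain ⟨t, ht⟩ := isCompact_univ.elim_finite_subcover (fun l : L.carrier => Metric.ball (j l) ε)
    (fun _ => Metric.isOpen_ball) (fun y _ => by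
      obtain ⟨l, hl⟩ := hjd.exists_dist_lt y hε
      exact Set.mem_iUnion.2 ⟨l, hl⟩)
  let ι : Type u := (insert L.base t : Finset L.carrier)
  let i₀ : ι := ⟨L.base, Finset.mem_insert_self _ _⟩
  have hnet : ∀ y : Y.carrier, ∃ i : ι, dist y (j i.1) < ε := by
    intro y
    obtain ⟨l, hl, hy⟩ := Set.mem_iUnion₂.1 (ht (Set.mem_univ y))
    exact ⟨⟨l, Finset.mem_insert_of_mem hl⟩, hy⟩
  obtain ⟨a, ha0, ha⟩ := ultralimit.exists_rep U (fun i : ι => i.1) i₀ rfl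
  have hdist : ∀ᶠ n in U, ∀ i i' : ι,
      |dist (α := (X n).carrier) (a i n) (a i' n) - dist (j i.1) (j i'.1)| ≤ 2 * ε := by
    refine eventually_all.2 fun i => eventually_all.2 fun i' => ?_
    have hlim := ultralimit.tendsto_edist U (a i) (a i')
    rw [ha, ha, ← hj.edist_eq] at hlim
    have hlim' : Tendsto (fun n => dist (α := (X n).carrier) (a i n) (a i' n)) U
        (𝓝 (dist (j i.1) (j i'.1))) := by
      rw [dist_edist (j i.1)]
      refine ((ENNReal.tendsto_toReal (edist_ne_top _ _)).comp hlim).congr fun n => ?_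
      exact (dist_edist (α := (X n).carrier) _ _).symm
    filter_upwards [Metric.tendsto_nhds.1 hlim' (2 * ε) (by linarith)] with n hn
    exact hn.le
  have hnetX : ∀ᶠ n in U, ∀ b : (X n).carrier, ∃ i : ι, edist b (a i n) < ENNReal.ofReal ε := by
    -- `b n` is a point missed by the lifted net, if one exists. The class of `b` in `L` is within
    -- `ε` of the net, so `U`-almost no `b n` is missed.
    have hb : ∀ n, ∃ b : (X n).carrier, (∃ i : ι, edist b (a i n) < ENNReal.ofReal ε) →
        ∀ b : (X n).carrier, ∃ i : ι, edist b (a i n) < ENNReal.ofReal ε := by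
      intro n
      by_cases hn : ∀ b : (X n).carrier, ∃ i : ι, edist b (a i n) < ENNReal.ofReal ε
      · exact ⟨(X n).base, fun _ => hn⟩
      · obtain ⟨b, hb⟩ := not_forall.1 hn
        exact ⟨b, fun h => absurd h hb⟩
    choose b hb using hb
    obtain ⟨i, hi⟩ := hnet (j (ultralimit.mk U b))
    have hlim := ultralimit.tendsto_edist U b (a i)
    have hlt : edist (ultralimit.mk U b) (ultralimit.mk U (a i)) < ENNReal.ofReal ε := by
      rw [ha, ← hj.edist_eq, edist_dist]
      exact (ENNReal.ofReal_lt_ofReal_iff hε).2 hi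
    filter_upwards [hlim.eventually_lt_const hlt] with n hn using hb n ⟨i, hn⟩
  filter_upwards [hdist, hnetX] with n hn hn'
  refine ptGHDist_le_of_nets (fun i : ι => a i n) (fun i : ι => j i.1) i₀ (congrFun ha0 n) hj0 hε
    (fun b => ?_) (fun y => (hnet y).imp fun _ h => h.le) hn
  obtain ⟨i, hi⟩ := hn' b
  refine ⟨i, (dist_edist _ _).trans_le ?_⟩
  exact ENNReal.toReal_le_of_le_ofReal hε.le hi.le

/-- The pulled-back neighbourhood filter is countably generated, so sequences suffice, and their
convergence can be tested on ultrafilters finer than `atTop`. There the ultralimit is equivalent to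
the limit space. -/
theorem isInducing_toMSpace : IsInducing PtGHSpace.toMSpace.{u} := by
  refine isInducing_iff_nhds.2 fun x => le_antisymm
    (lipschitzWith_toMSpace.continuous.tendsto x).le_comap ?_
  suffices Tendsto id (comap PtGHSpace.toMSpace (𝓝 x.toMSpace)) (𝓝 x) from this
  refine tendsto_of_seq_tendsto fun v hv => ?_
  rw [tendsto_comap_iff] at hv
  rw [tendsto_iff_ultrafilter]
  intro U hU
  obtain ⟨Y, rfl⟩ := Quotient.exists_rep x
  choose X hX using fun n => Quotient.exists_rep (v n)
  obtain rfl : (fun n => PtGHSpace.mk (X n)) = v := funext hX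
  have hlim := MSpace.tendsto_mk.1 (hv.mono_left hU)
  have hequiv := ultralimit_equiv_of_tendsto hlim
  refine Metric.tendsto_nhds.2 fun ε hε => ?_
  filter_upwards [eventually_ptGHDist_le hequiv (show 0 < ε / 4 by positivity)] with n hn
  exact lt_of_le_of_lt hn (by linarith)

/-- Injectivity is automatic for an inducing map on a T0 space. -/
theorem isEmbedding_toMSpace : IsEmbedding PtGHSpace.toMSpace.{u} :=
  isInducing_toMSpace.isEmbedding

end MSpaceMetric

theorem mainTheorem3 :
    ∃ _ : MetricSpace MSpace.{u},
      (∀ X Y : PtEMet.{u}, edist (MSpace.mk X) (MSpace.mk Y) = rho X Y) ∧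
      CompactSpace MSpace.{u} ∧
      LipschitzWith 3 PtGHSpace.toMSpace.{u} ∧
      IsEmbedding PtGHSpace.toMSpace.{u} ∧
      DenseRange PtGHSpace.toMSpace.{u} ∧
      ∀ (X : ℕ → PtEMet.{u}) (Y : PtEMet.{u}),
        Tendsto (fun n => rho (X n) Y) atTop (𝓝 0) →
        ∀ U : Ultrafilter ℕ, (∀ n, U ≠ pure n) → ultralimit U X ≈ Y := by
  refine ⟨MSpace.metricSpace, MSpace.edist_mk, MSpace.compactSpace, lipschitzWith_toMSpace,
    isEmbedding_toMSpace, denseRange_toMSpace, fun X Y h U hU => ?_⟩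
  refine ultralimit_equiv_of_tendsto (h.mono_left ?_)
  rw [← Nat.cofinite_eq_atTop]
  exact U.le_cofinite_or_eq_pure.resolve_right fun ⟨n, hn⟩ => hU n hn
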